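/- Let $R$ be a resource semiring, i.e. a (not necessarily commutative) semiring with a partial order for which $+$ and $\cdot$ are monotone in both arguments. **Doctrines.** A *primary linear doctrine* is a functor $P:\mathcal C^{op}\to \mathbf{Pos}$ on a category $\mathcal C$ with chosen finite products, whose fibres $P(X)$ are ordered commutative monoids $(P(X),\le,\ast,\kappa)$ and whose reindexing maps $P_t$ are monoid homomorphisms. An *$R$-graded doctrine* is such a $P$ with natural transformations $m_r:P\to P$ ($r\in R$) such that, in every fibre, $\kappa\le m_r\kappa$, $m_r\alpha\ast m_r\beta\le m_r(\alpha\ast\beta)$, $m_0\alpha\le\kappa$, $m_{r+s}\alpha\le m_r\alpha\ast m_s\alpha$, $m_1\alpha\le\alpha$, $m_{rs}\alpha\le m_rm_s\alpha$, and $m_r\alpha\le m_s\alpha$ whenever $s\le r$. A *distance* on $A\in\mathcal C$ is $\rho\in P(A\times A)$ with $\kappa\le P_{\langle id,id\rangle}\rho$, $\rho\le P_{\langle\pi_2,\pi_1\rangle}\rho$ and $P_{\langle\pi_1,\pi_2\rangle}\rho\ast P_{\langle\pi_2,\pi_3\rangle}\rho\le P_{\langle\pi_1,\pi_3\rangle}\rho$;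 it is *affine* if $\rho\le\kappa$. For distances $\rho$ on $A$ and $\sigma$ on $B$ put $\rho\boxtimes\sigma=P_{\pi_1\times\pi_1}\rho\ast P_{\pi_2\times\pi_2}\sigma\in P((A\times B)\times(A\times B))$. An *$R$-Lipschitz doctrine* is an $R$-graded doctrine with a distance $\delta_A$ on each object $A$ such that, for all $A,X$: (a) for each $\alpha\in P(X\times A)$ there is $r\in R$ with $P_{\langle\pi_1,\pi_2\rangle}\alpha\ast m_rP_{\langle\pi_2,\pi_3\rangle}\delta_A\le P_{\langle\pi_1,\pi_3\rangle}\alpha$ over $X\times A\times A$; (b) $\delta_{A\times X}=\delta_A\boxtimes\delta_X$; (c) $\delta_{A\times X}\le P_{\pi_1\times\pi_1}\delta_A$ and $\delta_{A\times X}\le P_{\pi_2\times\pi_2}\delta_X$; (d) $\delta_1=\kappa$. **2-categories.** In the 2-category $\mathbf{GD}_R$ of $R$-graded doctrines, a 1-arrow $(F,f):P\to Q$ consists of a functor $F$ between the bases that strictly preserves the chosen finite products and a natural transformation $f:P\to Q\circ F^{op}$ whose components are monotone monoid homomorphisms commuting with every $m_r$; a 2-arrow $(F,f)\Rightarrow(G,g)$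 is a natural transformation $\theta:F\to G$ with $f_X(\alpha)\le Q_{\theta_X}(g_X(\alpha))$ for all $X$ and $\alpha\in P(X)$. In the 2-category $\mathbf{LD}_R$ of $R$-Lipschitz doctrines, 1-arrows are those $(F,f)$ with $\delta'_{FA}=f_{A\times A}(\delta_A)$ for all $A$, and 2-arrows are as before. Let $U:\mathbf{LD}_R\to\mathbf{GD}_R$ be the forgetful 2-functor. **Lipschitz completion.** For an $R$-graded doctrine $P$, the $R$-Lipschitz doctrine $M(P)$ has the following data. Objects of its base are pairs $(A,\rho)$ with $\rho$ an affine distance on $A$; arrows $(A,\rho)\to(B,\sigma)$ are arrows $t:A\to B$ with $m_r\rho\le P_{t\times t}\sigma$ for some $r\in R$; the chosen products are $(A\times B,\rho\boxtimes\sigma)$ and $(1,\kappa)$. The fibre over $(A,\rho)$ is the set of $\alpha\in P(A)$ with $P_{\pi_1}\alpha\ast m_r\rho\le P_{\pi_2}\alpha$ for some $r\in R$, with order, monoid structure, reindexing and modalities inherited from $P$; the distance on $(A,\rho)$ is $\rho$. On arrows, $M(F,f)=(\overline F,f)$ with $\overline F(A,\rho)=(FA,f_{A\times A}(\rho))$ and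 $\overline Ft=Ft$, and $M(\theta)=\theta$. This defines a 2-functor $M:\mathbf{GD}_R\to\mathbf{LD}_R$. **Theorem.** The forgetful 2-functor $U:\mathbf{LD}_R\to\mathbf{GD}_R$ is 2-comonadic. That is: 1. $M$ is right 2-adjoint to $U$. The counit at $P$ is the 1-arrow $UM(P)\to P$ sending $(A,\rho)$ to $A$, identical on arrows and including the fibre over $(A,\rho)$ into $P(A)$; the unit at an $R$-Lipschitz doctrine $Q$ is the 1-arrow $Q\to MU(Q)$ sending $A$ to $(A,\delta_A)$, identical on arrows and on fibres. 2. The comparison 2-functor from $\mathbf{LD}_R$ to the 2-category of (strict) coalgebras, strict coalgebra morphisms and coalgebra 2-cells of the induced 2-comonad $U\circ M$ on $\mathbf{GD}_R$ is an isomorphism of 2-categories. -/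

import Mathlib

namespace TwoCat

open CategoryTheory Bicategory

universe w₁ w₂ v₁ v₂ u₁ u₂

variable {B : Type u₁} [Bicategory.{w₁, v₁} B] {C : Type u₂} [Bicategory.{w₂, v₂} C]

/-- A (strict) 2-natural transformation between 2-functors. -/
structure TwoNatTrans (F G : StrictPseudofunctor B C) where
  app (a : B) : F.obj a ⟶ G.obj a
  naturality {a b : B} (f : a ⟶ b) : F.map f ≫ app b = app a ≫ G.map f
  naturality₂ {a b : B} {f g : a ⟶ b} (η : f ⟶ g) :
    F.map₂ η ▷ app b =
      eqToHom (naturality f) ≫ (app a ◁ G.map₂ η) ≫ eqToHom (naturality g).symm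

/-- A 2-adjunction `L ⊣ R` (unit and counit 2-natural, triangle identities strict). -/
structure TwoAdjunction (L : StrictPseudofunctor B C) (R : StrictPseudofunctor C B) where
  unit : TwoNatTrans (StrictPseudofunctor.id B) (L.comp R)
  counit : TwoNatTrans (R.comp L) (StrictPseudofunctor.id C)
  left_triangle (a : B) :
    (L.map (unit.app a) : L.obj a ⟶ L.obj (R.obj (L.obj a))) ≫ counit.app (L.obj a) = 𝟙 (L.obj a)
  right_triangle (x : C) :
    (unit.app (R.obj x) : R.obj x ⟶ R.obj (L.obj (R.obj x))) ≫ R.map (counit.app x)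
      = 𝟙 (R.obj x)

/-- A 2-comonad on a 2-category. -/
structure TwoComonad (C : Type u₂) [Bicategory.{w₂, v₂} C] where
  T : StrictPseudofunctor C C
  counit : TwoNatTrans T (StrictPseudofunctor.id C)
  comult : TwoNatTrans T (T.comp T)
  counit_left (x : C) :
    (comult.app x : T.obj x ⟶ T.obj (T.obj x)) ≫ counit.app (T.obj x) = 𝟙 (T.obj x)
  counit_right (x : C) :
    (comult.app x : T.obj x ⟶ T.obj (T.obj x)) ≫ T.map (counit.app x) = 𝟙 (T.obj x)
  coassoc (x : C) :
    (comult.app x : T.obj x ⟶ T.obj (T.obj x)) ≫ comult.app (T.obj x) =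
      comult.app x ≫ T.map (comult.app x)

section transport

lemma conj_eqToHom_cancel {D : Type u₁} [Category.{v₁} D] {a b c d a' b' c' d' : D}
    {x : a ⟶ b} {y : c ⟶ d} {e₁ : a' = a} {e₂ : b = b'} {e₃ : a' = c'} {e₄ : c' = c} {e₅ : d = d'}
    {e₆ : d' = b'} (h : eqToHom e₁ ≫ x ≫ eqToHom e₂ =
      eqToHom e₃ ≫ (eqToHom e₄ ≫ y ≫ eqToHom e₅) ≫ eqToHom e₆) :
    x = eqToHom (e₁.symm.trans (e₃.trans e₄)) ≫ y ≫ eqToHom (e₅.trans (e₆.trans e₂.symm)) := by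
  subst e₁ e₂ e₃ e₄ e₅; simpa using h

lemma whiskerRight_congr {a b c : C} {f f' : a ⟶ b} (η : f ⟶ f') {g g' : b ⟶ c} (h : g = g') :
    η ▷ g = eqToHom (by rw [h]) ≫ η ▷ g' ≫ eqToHom (by rw [h]) := by
  subst h; simp

lemma whiskerLeft_congr {a b c : C} {f f' : a ⟶ b} (h : f = f') {g g' : b ⟶ c} (η : g ⟶ g') :
    f ◁ η = eqToHom (by rw [h]) ≫ f' ◁ η ≫ eqToHom (by rw [h]) := by
  subst h; simp

lemma map₂_whiskerLeft_eq (F : StrictPseudofunctor B C) {a b c : B} (f : a ⟶ b)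
    {g g' : b ⟶ c} (η : g ⟶ g') :
    F.map₂ (f ◁ η) = eqToHom (F.map_comp f g) ≫ (F.map f ◁ F.map₂ η) ≫
      eqToHom (F.map_comp f g').symm := by
  rw [F.map₂_whisker_left]; simp [F.mapComp_eq_eqToIso]

lemma map₂_whiskerRight_eq (F : StrictPseudofunctor B C) {a b c : B} {f f' : a ⟶ b}
    (η : f ⟶ f') (g : b ⟶ c) :
    F.map₂ (η ▷ g) = eqToHom (F.map_comp f g) ≫ (F.map₂ η ▷ F.map g) ≫
      eqToHom (F.map_comp f' g).symm := by
  rw [F.map₂_whisker_right]; simp [F.mapComp_eq_eqToIso]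

variable [Strict C]

lemma whiskerRight_comp_eq {a b c d : C} {f f' : a ⟶ b} (η : f ⟶ f') (g : b ⟶ c) (h : c ⟶ d) :
    η ▷ (g ≫ h) = eqToHom (Strict.assoc f g h).symm ≫ (η ▷ g) ▷ h ≫
      eqToHom (Strict.assoc f' g h) := by
  rw [whiskerRight_comp]; simp [Strict.associator_eqToIso]

lemma comp_whiskerLeft_eq {a b c d : C} (f : a ⟶ b) (g : b ⟶ c) {h h' : c ⟶ d} (η : h ⟶ h') :
    (f ≫ g) ◁ η = eqToHom (Strict.assoc f g h) ≫ f ◁ g ◁ η ≫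
      eqToHom (Strict.assoc f g h').symm := by
  rw [comp_whiskerLeft]; simp [Strict.associator_eqToIso]

lemma whisker_assoc_eq {a b c d : C} (f : a ⟶ b) {g g' : b ⟶ c} (η : g ⟶ g') (h : c ⟶ d) :
    (f ◁ η) ▷ h = eqToHom (Strict.assoc f g h) ≫ f ◁ (η ▷ h) ≫
      eqToHom (Strict.assoc f g' h).symm := by
  rw [whisker_assoc]; simp [Strict.associator_eqToIso]

end transport

namespace TwoAdjunction

variable {L : StrictPseudofunctor B C} {R : StrictPseudofunctor C B}

/-- The 2-comonad `L R` induced by a 2-adjunction `L ⊣ R`. -/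
def comonad (adj : TwoAdjunction L R) : TwoComonad C where
  T := R.comp L
  counit := adj.counit
  comult :=
    { app x := L.map (adj.unit.app (R.obj x))
      naturality {x y} f := by
        have h := congrArg L.map (adj.unit.naturality (R.map f))
        exact (L.map_comp _ _).symm.trans (h.trans (L.map_comp _ _))
      naturality₂ {x y f g} η := by
        have h := congrArg L.map₂ (adj.unit.naturality₂ (R.map₂ η))
        rw [L.map₂_comp, L.map₂_comp, PrelaxFunctor.map₂_eqToHom, PrelaxFunctor.map₂_eqToHom] at h
        have h1 := map₂_whiskerRight_eq L (R.map₂ η) (adj.unit.app (R.obj y))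
        have h2 := map₂_whiskerLeft_eq L (adj.unit.app (R.obj x)) (R.map₂ (L.map₂ (R.map₂ η)))
        have h3 := (h1.symm.trans h).trans
          (congrArg (fun t => eqToHom _ ≫ t ≫ eqToHom _) h2)
        exact conj_eqToHom_cancel h3 }
  counit_left x := adj.left_triangle (R.obj x)
  counit_right x := by
    have h := congrArg L.map (adj.right_triangle x)
    exact (L.map_comp _ _).symm.trans (h.trans (L.map_id _))
  coassoc x := by
    have h := congrArg L.map (adj.unit.naturality (adj.unit.app (R.obj x)))
    exact (L.map_comp _ _).symm.trans (h.trans (L.map_comp _ _))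

end TwoAdjunction

namespace TwoComonad

variable (G : TwoComonad C)

/-- A (strict) coalgebra for a 2-comonad. -/
structure Coalgebra where
  X : C
  str : X ⟶ G.T.obj X
  counit : str ≫ G.counit.app X = 𝟙 X
  coassoc : (str ≫ G.comult.app X : X ⟶ G.T.obj (G.T.obj X)) = str ≫ G.T.map str

variable {G}

namespace Coalgebra

/-- A (strict) morphism of coalgebras. -/
@[ext]
structure Hom (a b : G.Coalgebra) where
  f : a.X ⟶ b.X
  comm : f ≫ b.str = a.str ≫ G.T.map f

variable [Strict C]

instance : CategoryStruct G.Coalgebra where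
  Hom a b := Hom a b
  id a := ⟨𝟙 a.X, by rw [Strict.id_comp, G.T.map_id, Strict.comp_id]⟩
  comp {a b c} φ ψ := ⟨φ.f ≫ ψ.f, by
    rw [Strict.assoc, ψ.comm, ← Strict.assoc, φ.comm, Strict.assoc, G.T.map_comp]⟩

@[simp] lemma id_f (a : G.Coalgebra) : Hom.f (𝟙 a) = 𝟙 a.X := rfl
@[simp] lemma comp_f {a b c : G.Coalgebra} (φ : a ⟶ b) (ψ : b ⟶ c) :
    Hom.f (φ ≫ ψ) = φ.f ≫ ψ.f := rfl

/-- A 2-cell between morphisms of coalgebras. -/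
@[ext]
structure Hom₂ {a b : G.Coalgebra} (φ ψ : a ⟶ b) where
  η : φ.f ⟶ ψ.f
  comm : η ▷ b.str = eqToHom φ.comm ≫ (a.str ◁ G.T.map₂ η) ≫ eqToHom ψ.comm.symm

instance (a b : G.Coalgebra) : Category (a ⟶ b) where
  Hom φ ψ := Hom₂ φ ψ
  id φ := ⟨𝟙 φ.f, by simp⟩
  comp α β := ⟨α.η ≫ β.η, by simp [α.comm, β.comm]⟩

@[ext]
lemma hom₂_ext {a b : G.Coalgebra} {φ ψ : a ⟶ b} {α β : φ ⟶ ψ} (h : α.η = β.η) : α = β :=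
  Hom₂.ext h

@[simp] lemma id_η {a b : G.Coalgebra} (φ : a ⟶ b) : Hom₂.η (𝟙 φ) = 𝟙 φ.f := rfl
@[simp] lemma comp_η {a b : G.Coalgebra} {φ ψ χ : a ⟶ b} (α : φ ⟶ ψ) (β : ψ ⟶ χ) :
    Hom₂.η (α ≫ β) = α.η ≫ β.η := rfl

lemma eqToHom_η {a b : G.Coalgebra} {φ ψ : a ⟶ b} (h : φ = ψ) :
    Hom₂.η (eqToHom h) = eqToHom (congrArg Hom.f h) := by subst h; rfl

lemma hcomp_assoc {a b c d : G.Coalgebra} (φ : a ⟶ b) (ψ : b ⟶ c) (χ : c ⟶ d) :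
    (φ ≫ ψ) ≫ χ = φ ≫ ψ ≫ χ := Hom.ext (Strict.assoc _ _ _)
lemma hid_comp {a b : G.Coalgebra} (φ : a ⟶ b) : 𝟙 a ≫ φ = φ := Hom.ext (Strict.id_comp _)
lemma hcomp_id {a b : G.Coalgebra} (φ : a ⟶ b) : φ ≫ 𝟙 b = φ := Hom.ext (Strict.comp_id _)

def whiskerL {a b c : G.Coalgebra} (φ : a ⟶ b) {ψ χ : b ⟶ c} (α : ψ ⟶ χ) : φ ≫ ψ ⟶ φ ≫ χ :=
  Hom₂.mk (φ := φ ≫ ψ) (ψ := φ ≫ χ) (φ.f ◁ α.η) (by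
    dsimp only [comp_f]
    have h1 := comp_whiskerLeft_eq φ.f b.str (G.T.map₂ α.η)
    rw [whiskerLeft_congr φ.comm, comp_whiskerLeft_eq, eq_comm, eqToHom_comp_iff,
      comp_eqToHom_iff] at h1
    rw [whisker_assoc_eq, α.comm, map₂_whiskerLeft_eq]
    simp only [Bicategory.whiskerLeft_comp, whiskerLeft_eqToHom, Category.assoc, eqToHom_trans,
      eqToHom_trans_assoc, h1])

def whiskerR {a b c : G.Coalgebra} {φ ψ : a ⟶ b} (α : φ ⟶ ψ) (χ : b ⟶ c) : φ ≫ χ ⟶ ψ ≫ χ :=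
  Hom₂.mk (φ := φ ≫ χ) (ψ := ψ ≫ χ) (α.η ▷ χ.f) (by
    dsimp only [comp_f]
    have h1 := whiskerRight_comp_eq α.η χ.f c.str
    rw [whiskerRight_congr _ χ.comm, whiskerRight_comp_eq, α.comm, eq_comm, eqToHom_comp_iff,
      comp_eqToHom_iff] at h1
    rw [h1, map₂_whiskerRight_eq]
    simp only [Bicategory.comp_whiskerRight, eqToHom_whiskerRight, Category.assoc, eqToHom_trans,
      eqToHom_trans_assoc, whisker_assoc_eq, Bicategory.whiskerLeft_comp, whiskerLeft_eqToHom])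

instance : Bicategory G.Coalgebra where
  whiskerLeft φ _ _ α := whiskerL φ α
  whiskerRight α χ := whiskerR α χ
  associator φ ψ χ := eqToIso (hcomp_assoc φ ψ χ)
  leftUnitor φ := eqToIso (hid_comp φ)
  rightUnitor φ := eqToIso (hcomp_id φ)
  whiskerLeft_id φ ψ := hom₂_ext (Bicategory.whiskerLeft_id _ _)
  whiskerLeft_comp φ _ _ _ α β := hom₂_ext (Bicategory.whiskerLeft_comp _ _ _)
  id_whiskerRight φ ψ := hom₂_ext (Bicategory.id_whiskerRight _ _)
  comp_whiskerRight α β χ := hom₂_ext (Bicategory.comp_whiskerRight _ _ _)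
  id_whiskerLeft α := by
    apply hom₂_ext
    refine (Bicategory.id_whiskerLeft _).trans ?_
    simp [Strict.leftUnitor_eqToIso, eqToHom_η]
  comp_whiskerLeft φ ψ _ _ α := by
    apply hom₂_ext
    refine (comp_whiskerLeft_eq _ _ _).trans ?_
    simp [eqToHom_η, whiskerL]
  whiskerRight_id α := by
    apply hom₂_ext
    refine (Bicategory.whiskerRight_id _).trans ?_
    simp [Strict.rightUnitor_eqToIso, eqToHom_η]
  whiskerRight_comp α φ ψ := by
    apply hom₂_ext
    refine (whiskerRight_comp_eq _ _ _).trans ?_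
    simp [eqToHom_η, whiskerR]
  whisker_assoc φ _ _ α ψ := by
    apply hom₂_ext
    refine (whisker_assoc_eq _ _ _).trans ?_
    simp [eqToHom_η, whiskerL, whiskerR]
  whisker_exchange α β := hom₂_ext (Bicategory.whisker_exchange _ _)
  pentagon φ ψ χ ω := by
    apply hom₂_ext
    simp [eqToHom_η, whiskerL, whiskerR]
  triangle φ ψ := by
    apply hom₂_ext
    simp [eqToHom_η, whiskerL, whiskerR]

instance : Strict G.Coalgebra where
  id_comp := hid_comp
  comp_id := hcomp_id
  assoc := hcomp_assoc
  leftUnitor_eqToIso _ := rfl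
  rightUnitor_eqToIso _ := rfl
  associator_eqToIso _ _ _ := rfl

end Coalgebra
end TwoComonad

namespace TwoAdjunction

variable [Strict B] [Strict C] {L : StrictPseudofunctor B C} {R : StrictPseudofunctor C B}

/-- The comparison 2-functor to the 2-category of coalgebras of the induced 2-comonad. -/
def comparison (adj : TwoAdjunction L R) : StrictPseudofunctor B adj.comonad.Coalgebra :=
  StrictPseudofunctor.mk''
    { obj a :=
        { X := L.obj a
          str := L.map (adj.unit.app a)
          counit := adj.left_triangle a
          coassoc := by
            have h := congrArg L.map (adj.unit.naturality (adj.unit.app a))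
            exact (L.map_comp _ _).symm.trans (h.trans (L.map_comp _ _)) }
      map f :=
        { f := L.map f
          comm := by
            have h := congrArg L.map (adj.unit.naturality f)
            exact (L.map_comp _ _).symm.trans (h.trans (L.map_comp _ _)) }
      map₂ {a b f g} η :=
        { η := L.map₂ η
          comm := by
            have h := congrArg L.map₂ (adj.unit.naturality₂ η)
            rw [L.map₂_comp, L.map₂_comp, PrelaxFunctor.map₂_eqToHom,
              PrelaxFunctor.map₂_eqToHom] at h
            have h1 := map₂_whiskerRight_eq L η (adj.unit.app b)
            have h2 := map₂_whiskerLeft_eq L (adj.unit.app a) (R.map₂ (L.map₂ η))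
            have h3 := (h1.symm.trans h).trans
              (congrArg (fun t => eqToHom _ ≫ t ≫ eqToHom _) h2)
            exact conj_eqToHom_cancel h3 }
      map₂_id f := TwoComonad.Coalgebra.hom₂_ext (L.map₂_id f)
      map₂_comp η θ := TwoComonad.Coalgebra.hom₂_ext (L.map₂_comp η θ)
      map_id a := TwoComonad.Coalgebra.Hom.ext (L.map_id a)
      map_comp f g := TwoComonad.Coalgebra.Hom.ext (L.map_comp f g)
      map₂_whisker_left f _ _ η := TwoComonad.Coalgebra.hom₂_ext <| by
        refine (map₂_whiskerLeft_eq L f η).trans ?_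
        simp only [TwoComonad.Coalgebra.comp_η, TwoComonad.Coalgebra.eqToHom_η]
        rfl
      map₂_whisker_right η g := TwoComonad.Coalgebra.hom₂_ext <| by
        refine (map₂_whiskerRight_eq L η g).trans ?_
        simp only [TwoComonad.Coalgebra.comp_η, TwoComonad.Coalgebra.eqToHom_η]
        rfl }

end TwoAdjunction

/-- A 2-functor is an isomorphism of 2-categories if it has a strict two-sided inverse
2-functor. -/
def IsIsoOfTwoCategories (F : StrictPseudofunctor B C) : Prop :=
  ∃ G : StrictPseudofunctor C B,
    F.comp G = StrictPseudofunctor.id B ∧ G.comp F = StrictPseudofunctor.id C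

end TwoCat

namespace LipDoc

open CategoryTheory Opposite

universe u v w u' v' u'' v''

section


/-- A resource semiring: a semiring in the category of posets. -/
class ResourceSemiring (R : Type*) extends Semiring R, PartialOrder R where
  add_mono : ∀ {r r' s s' : R}, r ≤ r' → s ≤ s' → r + s ≤ r' + s'
  mul_mono : ∀ {r r' s s' : R}, r ≤ r' → s ≤ s' → r * s ≤ r' * s'

section Doctrines

open MonoidalCategory CartesianMonoidalCategory

/-- A doctrine: a category with (chosen) finite products and a functor `Cᵒᵖ ⥤ PartOrd`. -/
structure Doctrine where
  C : Type u
  [cat : Category.{v} C]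
  [prod : CartesianMonoidalCategory C]
  P : Cᵒᵖ ⥤ PartOrd.{w}

attribute [instance] Doctrine.cat Doctrine.prod

namespace Doctrine

variable (D : Doctrine.{u, v, w})

/-- The fibre over an object. -/
abbrev fib (X : D.C) : Type w := D.P.obj (op X)

/-- Reindexing along an arrow. -/
def re {X Y : D.C} (f : X ⟶ Y) (α : D.fib Y) : D.fib X := D.P.map f.op α

variable {D}

@[simp] lemma re_id {X : D.C} (α : D.fib X) : D.re (𝟙 X) α = α := by simp [re]

lemma re_comp {X Y Z : D.C} (f : X ⟶ Y) (g : Y ⟶ Z) (α : D.fib Z) :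
    D.re (f ≫ g) α = D.re f (D.re g α) := by simp [re]

lemma re_mono {X Y : D.C} (f : X ⟶ Y) {α β : D.fib Y} (h : α ≤ β) : D.re f α ≤ D.re f β :=
  (D.P.map f.op).hom.monotone h

end Doctrine

/-- A primary linear doctrine: each fibre is an ordered commutative monoid and the monoid
structure is preserved by reindexing. `α * β` and `1` are written `α ∗ β` and `κ` in the
literature. -/
structure LinearDoctrine extends Doctrine.{u, v, w} where
  [mon : ∀ X : C, CommMonoid (toDoctrine.fib X)]
  [ordMon : ∀ X : C, IsOrderedMonoid (toDoctrine.fib X)]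
  re_mul : ∀ {X Y : C} (f : X ⟶ Y) (α β : toDoctrine.fib Y),
    toDoctrine.re f (α * β) = toDoctrine.re f α * toDoctrine.re f β
  re_one : ∀ {X Y : C} (f : X ⟶ Y), toDoctrine.re f (1 : toDoctrine.fib Y) = 1

attribute [instance] LinearDoctrine.mon LinearDoctrine.ordMon

namespace LinearDoctrine

variable {D : LinearDoctrine.{u, v, w}}

/-- `ρ` is a distance on the object `A`. In `A ⊗ (A ⊗ A)` the three projections are
`fst`, `snd ≫ fst` and `snd ≫ snd`. -/
structure IsDistance (A : D.C) (ρ : D.fib (A ⊗ A)) : Prop where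
  refl : 1 ≤ D.re (lift (𝟙 A) (𝟙 A)) ρ
  symm : ρ ≤ D.re (lift (snd A A) (fst A A)) ρ
  trans :
    D.re (lift (fst A (A ⊗ A)) (snd A (A ⊗ A) ≫ fst A A)) ρ *
        D.re (lift (snd A (A ⊗ A) ≫ fst A A) (snd A (A ⊗ A) ≫ snd A A)) ρ ≤
      D.re (lift (fst A (A ⊗ A)) (snd A (A ⊗ A) ≫ snd A A)) ρ

/-- An element of a fibre is affine if it lies below the monoid unit. -/
def IsAffine {X : D.C} (α : D.fib X) : Prop := α ≤ 1

/-- The product `ρ ⊠ σ` of two distances, i.e. `ρ(π₁, π₃) * σ(π₂, π₄)`. -/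
def boxDist {A B : D.C} (ρ : D.fib (A ⊗ A)) (σ : D.fib (B ⊗ B)) : D.fib ((A ⊗ B) ⊗ (A ⊗ B)) :=
  D.re (fst A B ⊗ₘ fst A B) ρ * D.re (snd A B ⊗ₘ snd A B) σ

end LinearDoctrine

/-- An `R`-graded doctrine: a primary linear doctrine with an `R`-graded linear exponential
modality. -/
structure GradedDoctrine (R : Type*) [ResourceSemiring R] extends LinearDoctrine.{u, v, w} where
  mod : R → (P ⟶ P)
  one_le_mod : ∀ (r : R) (X : C), (1 : toDoctrine.fib X) ≤ (mod r).app (op X) 1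
  mod_mul : ∀ (r : R) {X : C} (α β : toDoctrine.fib X),
    (mod r).app (op X) α * (mod r).app (op X) β ≤ (mod r).app (op X) (α * β)
  mod_zero : ∀ {X : C} (α : toDoctrine.fib X), (mod 0).app (op X) α ≤ (1 : toDoctrine.fib X)
  mod_add : ∀ (r s : R) {X : C} (α : toDoctrine.fib X),
    (mod (r + s)).app (op X) α ≤
      ((mod r).app (op X) α * (mod s).app (op X) α : toDoctrine.fib X)
  mod_one : ∀ {X : C} (α : toDoctrine.fib X), (mod 1).app (op X) α ≤ α
  mod_mul_grade : ∀ (r s : R) {X : C} (α : toDoctrine.fib X),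
    (mod (r * s)).app (op X) α ≤ (mod r).app (op X) ((mod s).app (op X) α)
  mod_anti : ∀ {r s : R}, s ≤ r → ∀ {X : C} (α : toDoctrine.fib X),
    (mod r).app (op X) α ≤ (mod s).app (op X) α

namespace GradedDoctrine

variable {R : Type*} [ResourceSemiring R]

/-- The component of the `r`-th modality on a fibre. -/
def bang (D : GradedDoctrine.{u, v, w} R) (r : R) {X : D.C} (α : D.fib X) : D.fib X :=
  (D.mod r).app (op X) α

variable {D : GradedDoctrine.{u, v, w} R}

lemma re_bang (r : R) {X Y : D.C} (f : X ⟶ Y) (α : D.fib Y) :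
    D.re f (D.bang r α) = D.bang r (D.re f α) :=
  (ConcreteCategory.congr_hom ((D.mod r).naturality f.op) α).symm

lemma bang_mono (r : R) {X : D.C} {α β : D.fib X} (h : α ≤ β) : D.bang r α ≤ D.bang r β :=
  ((D.mod r).app (op X)).hom.monotone h

end GradedDoctrine

/-- An `R`-Lipschitz doctrine: an `R`-graded doctrine with a chosen distance `dist A` on every
object `A` of the base, satisfying graded substitutivity and independence of contexts. -/
structure LipschitzDoctrine (R : Type*) [ResourceSemiring R] extends
    GradedDoctrine.{u, v, w} R where
  dist : ∀ A : C, toDoctrine.fib (A ⊗ A)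
  isDistance : ∀ A : C, toLinearDoctrine.IsDistance A (dist A)
  subst : ∀ (A X : C) (α : toDoctrine.fib (X ⊗ A)), ∃ r : R,
    toDoctrine.re (lift (fst X (A ⊗ A)) (snd X (A ⊗ A) ≫ fst A A)) α *
        toGradedDoctrine.bang r (toDoctrine.re (snd X (A ⊗ A)) (dist A)) ≤
      toDoctrine.re (lift (fst X (A ⊗ A)) (snd X (A ⊗ A) ≫ snd A A)) α
  dist_prod : ∀ A X : C, dist (A ⊗ X) = toLinearDoctrine.boxDist (dist A) (dist X)
  dist_le_fst : ∀ A X : C, dist (A ⊗ X) ≤ toDoctrine.re (fst A X ⊗ₘ fst A X) (dist A)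
  dist_le_snd : ∀ A X : C, dist (A ⊗ X) ≤ toDoctrine.re (snd A X ⊗ₘ snd A X) (dist X)
  dist_unit : dist (𝟙_ C) = 1

/-- A functor between categories with chosen finite products preserves them strictly. -/
structure StrictlyPreservesProducts {C D : Type*} [Category* C] [Category* D]
    [CartesianMonoidalCategory C] [CartesianMonoidalCategory D] (F : C ⥤ D) : Prop where
  unit : F.obj (𝟙_ C) = 𝟙_ D
  prod (A B : C) : F.obj (A ⊗ B) = F.obj A ⊗ F.obj B
  map_fst (A B : C) : F.map (fst A B) = eqToHom (prod A B) ≫ fst (F.obj A) (F.obj B)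
  map_snd (A B : C) : F.map (snd A B) = eqToHom (prod A B) ≫ snd (F.obj A) (F.obj B)

lemma StrictlyPreservesProducts.id (C : Type*) [Category* C] [CartesianMonoidalCategory C] :
    StrictlyPreservesProducts (𝟭 C) :=
  ⟨rfl, fun _ _ => rfl, fun _ _ => by simp, fun _ _ => by simp⟩

lemma StrictlyPreservesProducts.comp {C D E : Type*} [Category* C] [Category* D] [Category* E]
    [CartesianMonoidalCategory C] [CartesianMonoidalCategory D] [CartesianMonoidalCategory E]
    {F : C ⥤ D} {G : D ⥤ E} (hF : StrictlyPreservesProducts F)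
    (hG : StrictlyPreservesProducts G) : StrictlyPreservesProducts (F ⋙ G) where
  unit := by rw [Functor.comp_obj, hF.unit, hG.unit]
  prod A B := by rw [Functor.comp_obj, hF.prod, hG.prod]; rfl
  map_fst A B := by simp [hF.map_fst, hG.map_fst, eqToHom_map]
  map_snd A B := by simp [hF.map_snd, hG.map_snd, eqToHom_map]

/-- The identification `F A × F B = F (A × B)`. -/
def StrictlyPreservesProducts.iso {C D : Type*} [Category* C] [Category* D]
    [CartesianMonoidalCategory C] [CartesianMonoidalCategory D] {F : C ⥤ D}
    (hF : StrictlyPreservesProducts F) (A B : C) : F.obj A ⊗ F.obj B ⟶ F.obj (A ⊗ B) :=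
  eqToHom (hF.prod A B).symm

end Doctrines

namespace GradedDoctrine

variable {R : Type*} [ResourceSemiring R]

/-- The component at `X` of a natural transformation `f : P ⟶ F.op ⋙ Q`. -/
def natApp {P : GradedDoctrine.{u, v, w} R} {Q : GradedDoctrine.{u', v', w} R} {F : P.C ⥤ Q.C}
    (f : P.P ⟶ F.op ⋙ Q.P) {X : P.C} (α : P.fib X) : Q.fib (F.obj X) := f.app (op X) α

/-- A 1-arrow of `R`-graded doctrines: a (strictly) finite product preserving functor `F` and a
natural transformation `f : P ⟶ F.op ⋙ Q` preserving the monoid structure and the modalities. -/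
structure Hom (P : GradedDoctrine.{u, v, w} R) (Q : GradedDoctrine.{u', v', w} R) where
  F : P.C ⥤ Q.C
  strict : StrictlyPreservesProducts F
  f : P.P ⟶ F.op ⋙ Q.P
  map_mul : ∀ {X : P.C} (α β : P.fib X),
    natApp f (α * β) = natApp f α * natApp f β
  map_one : ∀ X : P.C, natApp f (1 : P.fib X) = 1
  map_mod : ∀ (r : R) {X : P.C} (α : P.fib X),
    natApp f (P.bang r α) = Q.bang r (natApp f α)

namespace Hom

/-- The component of the natural transformation of a 1-arrow. -/
def app {P : GradedDoctrine.{u, v, w} R} {Q : GradedDoctrine.{u', v', w} R} (φ : Hom P Q)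
    {X : P.C} (α : P.fib X) : Q.fib (φ.F.obj X) := natApp φ.f α

variable {P : GradedDoctrine.{u, v, w} R} {Q : GradedDoctrine.{u', v', w} R}
  {S : GradedDoctrine.{u'', v'', w} R}

lemma app_re (φ : Hom P Q) {X Y : P.C} (g : X ⟶ Y) (α : P.fib Y) :
    φ.app (P.re g α) = Q.re (φ.F.map g) (φ.app α) :=
  ConcreteCategory.congr_hom (φ.f.naturality g.op) α

lemma app_mono (φ : Hom P Q) {X : P.C} {α β : P.fib X} (h : α ≤ β) : φ.app α ≤ φ.app β :=
  (φ.f.app (op X)).hom.monotone h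

lemma app_mul (φ : Hom P Q) {X : P.C} (α β : P.fib X) : φ.app (α * β) = φ.app α * φ.app β :=
  φ.map_mul α β

lemma app_one (φ : Hom P Q) (X : P.C) : φ.app (1 : P.fib X) = 1 := φ.map_one X

lemma app_bang (φ : Hom P Q) (r : R) {X : P.C} (α : P.fib X) :
    φ.app (P.bang r α) = Q.bang r (φ.app α) := φ.map_mod r α

variable (P) in
/-- The identity 1-arrow. -/
def id : Hom P P where
  F := 𝟭 P.C
  strict := .id _
  f := { app := fun _ => 𝟙 _ }
  map_mul _ _ := rfl
  map_one _ := rfl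
  map_mod _ _ _ := rfl

/-- Composition of 1-arrows. -/
def comp (φ : Hom P Q) (ψ : Hom Q S) : Hom P S where
  F := φ.F ⋙ ψ.F
  strict := φ.strict.comp ψ.strict
  f :=
    { app := fun X => φ.f.app X ≫ ψ.f.app (op (φ.F.obj X.unop))
      naturality := fun X Y g => by
        have h1 := φ.f.naturality g
        have h2 := ψ.f.naturality (φ.F.map g.unop).op
        dsimp at h1 h2 ⊢
        rw [reassoc_of% h1, h2, Category.assoc] }
  map_mul α β := (congrArg (ψ.app) (φ.map_mul α β)).trans (ψ.map_mul _ _)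
  map_one X := (congrArg (ψ.app) (φ.map_one X)).trans (ψ.map_one _)
  map_mod r _ α := (congrArg (ψ.app) (φ.map_mod r α)).trans (ψ.map_mod r _)

@[simp] lemma comp_app (φ : Hom P Q) (ψ : Hom Q S) {X : P.C} (α : P.fib X) :
    (φ.comp ψ).app α = ψ.app (φ.app α) := rfl

@[simp] lemma id_app {X : P.C} (α : P.fib X) : (id P).app α = α := rfl

lemma ext_data {φ ψ : Hom P Q} (hobj : ∀ X, φ.F.obj X = ψ.F.obj X)
    (hmap : ∀ {X Y : P.C} (g : X ⟶ Y),
      φ.F.map g = eqToHom (hobj X) ≫ ψ.F.map g ≫ eqToHom (hobj Y).symm)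
    (happ : ∀ {X : P.C} (α : P.fib X), φ.app α = Q.re (eqToHom (hobj X)) (ψ.app α)) : φ = ψ := by
  have hF : φ.F = ψ.F := CategoryTheory.Functor.ext hobj (fun _ _ g => hmap g)
  obtain ⟨F, hs, f, h1, h2, h3⟩ := φ
  obtain ⟨G, hs', g, h1', h2', h3'⟩ := ψ
  dsimp only at hF
  subst hF
  congr
  ext X α
  simpa [app, natApp, Doctrine.re] using happ (X := X.unop) α

/-- The image of an element over `A × A`, as an element over `F A × F A = F (A × A)`. -/
def distMap (φ : Hom P Q) {A : P.C} (ρ : P.fib (MonoidalCategory.tensorObj A A)) :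
    Q.fib (MonoidalCategory.tensorObj (φ.F.obj A) (φ.F.obj A)) :=
  Q.re (φ.strict.iso A A) (φ.app ρ)

lemma distMap_id {A : P.C} (ρ : P.fib (MonoidalCategory.tensorObj A A)) :
    (id P).distMap ρ = ρ := Doctrine.re_id _

lemma distMap_comp (φ : Hom P Q) (ψ : Hom Q S) {A : P.C}
    (ρ : P.fib (MonoidalCategory.tensorObj A A)) :
    (φ.comp ψ).distMap ρ = ψ.distMap (φ.distMap ρ) := by
  change S.re (eqToHom _) (ψ.app (φ.app ρ)) =
    S.re (eqToHom _) (ψ.app (Q.re (eqToHom _) (φ.app ρ)))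
  rw [app_re, ← Doctrine.re_comp, eqToHom_map]
  exact congrArg (fun g => S.re g (ψ.app (φ.app ρ))) (eqToHom_trans _ _).symm

end Hom

/-- A 2-arrow `(F, f) ⟶ (G, g)`: a natural transformation `θ : F ⟶ G` with
`f_X ≤ Q(θ_X) ∘ g_X` for all `X`. -/
structure Hom₂ {P : GradedDoctrine.{u, v, w} R} {Q : GradedDoctrine.{u', v', w} R}
    (φ ψ : Hom P Q) where
  θ : φ.F ⟶ ψ.F
  ineq : ∀ {X : P.C} (α : P.fib X), φ.app α ≤ Q.re (θ.app X) (ψ.app α)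

instance : CategoryStruct (GradedDoctrine.{u, v, w} R) where
  Hom P Q := Hom P Q
  id P := Hom.id P
  comp φ ψ := Hom.comp φ ψ

section

variable {P Q S : GradedDoctrine.{u, v, w} R}

instance : Category (P ⟶ Q) where
  Hom φ ψ := Hom₂ φ ψ
  id φ := ⟨𝟙 φ.F, fun _ => by simp⟩
  comp {φ ψ χ} a b := ⟨a.θ ≫ b.θ, fun α => by
    rw [NatTrans.comp_app, Doctrine.re_comp]
    exact (a.ineq α).trans (Doctrine.re_mono _ (b.ineq α))⟩

/-- Vertical composition of 2-arrows. -/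
def compHom₂ {φ ψ χ : P ⟶ Q} (a : φ ⟶ ψ) (b : ψ ⟶ χ) : φ ⟶ χ := a ≫ b

lemma hom₂_ext {φ ψ : P ⟶ Q} {a b : φ ⟶ ψ} (h : ∀ X, a.θ.app X = b.θ.app X) : a = b := by
  obtain ⟨a, _⟩ := a
  obtain ⟨b, _⟩ := b
  obtain rfl : a = b := by ext X; exact h X
  rfl

@[simp] lemma id_θ (φ : P ⟶ Q) : Hom₂.θ (𝟙 φ) = 𝟙 φ.F := rfl
@[simp] lemma comp_θ {φ ψ χ : P ⟶ Q} (a : φ ⟶ ψ) (b : ψ ⟶ χ) :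
    Hom₂.θ (a ≫ b) = a.θ ≫ b.θ := rfl

lemma eqToHom_θ {φ ψ : P ⟶ Q} (h : φ = ψ) (X : P.C) :
    (Hom₂.θ (eqToHom h)).app X = eqToHom (by rw [h]) := by subst h; rfl

lemma hcomp_assoc {T : GradedDoctrine.{u, v, w} R} (φ : P ⟶ Q) (ψ : Q ⟶ S) (χ : S ⟶ T) :
    (φ ≫ ψ) ≫ χ = φ ≫ ψ ≫ χ := rfl
lemma hid_comp (φ : P ⟶ Q) : 𝟙 P ≫ φ = φ := rfl
lemma hcomp_id (φ : P ⟶ Q) : φ ≫ 𝟙 Q = φ := rfl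

lemma id_comp_id {C : Type*} [Category* C] {X Y : C} (f : X ⟶ Y) : 𝟙 X ≫ f ≫ 𝟙 Y = f := by simp

/-- Whiskering. -/
def whiskerL (φ : P ⟶ Q) {ψ χ : Q ⟶ S} (a : ψ ⟶ χ) : φ ≫ ψ ⟶ φ ≫ χ :=
  Hom₂.mk (φ := φ ≫ ψ) (ψ := φ ≫ χ) (Functor.whiskerLeft φ.F a.θ) (fun α => a.ineq (φ.app α))

/-- Whiskering. -/
def whiskerR {φ ψ : P ⟶ Q} (a : φ ⟶ ψ) (χ : Q ⟶ S) : φ ≫ χ ⟶ ψ ≫ χ :=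
  Hom₂.mk (φ := φ ≫ χ) (ψ := ψ ≫ χ) (Functor.whiskerRight a.θ χ.F) (fun α =>
    (χ.app_mono (a.ineq α)).trans_eq (χ.app_re _ _))

end

/-- The 2-category of `R`-graded doctrines. -/
instance : Bicategory (GradedDoctrine.{u, v, w} R) where
  homCategory _ _ := inferInstance
  whiskerLeft φ _ _ a := whiskerL φ a
  whiskerRight a χ := whiskerR a χ
  associator φ ψ χ := Iso.refl (φ ≫ ψ ≫ χ)
  leftUnitor φ := Iso.refl φ
  rightUnitor φ := Iso.refl φ
  whiskerLeft_id φ ψ := hom₂_ext fun X => rfl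
  whiskerLeft_comp φ _ _ _ a b := hom₂_ext fun X => rfl
  id_whiskerRight φ ψ := hom₂_ext fun X => ψ.F.map_id _
  comp_whiskerRight a b χ := hom₂_ext fun X => χ.F.map_comp _ _
  id_whiskerLeft a := hom₂_ext fun X => (id_comp_id _).symm
  comp_whiskerLeft φ ψ _ _ a := hom₂_ext fun X => (id_comp_id _).symm
  whiskerRight_id a := hom₂_ext fun X => (id_comp_id _).symm
  whiskerRight_comp a φ ψ := hom₂_ext fun X => (id_comp_id _).symm
  whisker_assoc φ _ _ a ψ := hom₂_ext fun X => (id_comp_id _).symm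
  whisker_exchange {_ _ _ _ _ _ _} a b := hom₂_ext fun X => ((Hom₂.θ b).naturality _).symm
  pentagon φ ψ χ ω := hom₂_ext fun X =>
    (congrArg₂ (· ≫ ·) (ω.F.map_id _) (Category.comp_id _)).trans rfl
  triangle φ ψ := hom₂_ext fun X => (Category.comp_id _).trans (ψ.F.map_id _).symm

instance : Bicategory.Strict (GradedDoctrine.{u, v, w} R) where
  id_comp := hid_comp
  comp_id := hcomp_id
  assoc := hcomp_assoc
  leftUnitor_eqToIso _ := rfl
  rightUnitor_eqToIso _ := rfl
  associator_eqToIso _ _ _ := rfl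

end GradedDoctrine

namespace LipschitzDoctrine

variable {R : Type*} [ResourceSemiring R]

/-- A 1-arrow of `R`-Lipschitz doctrines: a 1-arrow of the underlying `R`-graded doctrines
preserving the distances. -/
@[ext]
structure Hom (P Q : LipschitzDoctrine.{u, v, w} R) where
  toHom : P.toGradedDoctrine ⟶ Q.toGradedDoctrine
  map_dist : ∀ A : P.C, Q.dist (toHom.F.obj A) = GradedDoctrine.Hom.distMap toHom (P.dist A)


namespace Hom

/-- The identity 1-arrow. -/
def id (P : LipschitzDoctrine.{u, v, w} R) : Hom P P where
  toHom := 𝟙 P.toGradedDoctrine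
  map_dist A := (GradedDoctrine.Hom.distMap_id _).symm

/-- Composition of 1-arrows. -/
def comp {P Q S : LipschitzDoctrine.{u, v, w} R} (φ : Hom P Q) (ψ : Hom Q S) : Hom P S where
  toHom := φ.toHom ≫ ψ.toHom
  map_dist A := by
    refine (ψ.map_dist _).trans ?_
    rw [φ.map_dist]
    exact (GradedDoctrine.Hom.distMap_comp _ _ _).symm

end Hom

instance : CategoryStruct (LipschitzDoctrine.{u, v, w} R) where
  Hom P Q := Hom P Q
  id P := Hom.id P
  comp φ ψ := Hom.comp φ ψ

section

variable {P Q S : LipschitzDoctrine.{u, v, w} R}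

/-- The 2-arrows between 1-arrows of `R`-Lipschitz doctrines are those between the underlying
1-arrows of `R`-graded doctrines. -/
instance : Category (P ⟶ Q) where
  Hom φ ψ := Hom.toHom φ ⟶ Hom.toHom ψ
  id φ := 𝟙 (Hom.toHom φ)
  comp a b := GradedDoctrine.compHom₂ a b
  id_comp a := Category.id_comp (obj := P.toGradedDoctrine ⟶ Q.toGradedDoctrine) a
  comp_id a := Category.comp_id (obj := P.toGradedDoctrine ⟶ Q.toGradedDoctrine) a
  assoc a b c := Category.assoc (obj := P.toGradedDoctrine ⟶ Q.toGradedDoctrine) a b c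

end

open GradedDoctrine in
/-- The 2-category of `R`-Lipschitz doctrines. -/
instance : Bicategory (LipschitzDoctrine.{u, v, w} R) where
  homCategory _ _ := inferInstance
  whiskerLeft φ _ _ a := whiskerL (Hom.toHom φ) a
  whiskerRight a χ := whiskerR a (Hom.toHom χ)
  associator φ ψ χ := Iso.refl (φ ≫ ψ ≫ χ)
  leftUnitor φ := Iso.refl φ
  rightUnitor φ := Iso.refl φ
  whiskerLeft_id φ ψ := hom₂_ext fun X => rfl
  whiskerLeft_comp φ _ _ _ a b := hom₂_ext fun X => rfl
  id_whiskerRight φ ψ := hom₂_ext fun X => (Hom.toHom ψ).F.map_id _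
  comp_whiskerRight a b χ := hom₂_ext fun X => (Hom.toHom χ).F.map_comp _ _
  id_whiskerLeft a := hom₂_ext fun X => (id_comp_id _).symm
  comp_whiskerLeft φ ψ _ _ a := hom₂_ext fun X => (id_comp_id _).symm
  whiskerRight_id a := hom₂_ext fun X => (id_comp_id _).symm
  whiskerRight_comp a φ ψ := hom₂_ext fun X => (id_comp_id _).symm
  whisker_assoc φ _ _ a ψ := hom₂_ext fun X => (id_comp_id _).symm
  whisker_exchange {_ _ _ _ _ _ _} a b := hom₂_ext fun X => ((Hom₂.θ b).naturality _).symm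
  pentagon φ ψ χ ω := hom₂_ext fun X =>
    (congrArg₂ (· ≫ ·) ((Hom.toHom ω).F.map_id _) (Category.comp_id _)).trans rfl
  triangle φ ψ := hom₂_ext fun X => (Category.comp_id _).trans ((Hom.toHom ψ).F.map_id _).symm

instance : Bicategory.Strict (LipschitzDoctrine.{u, v, w} R) where
  id_comp _ := rfl
  comp_id _ := rfl
  assoc _ _ _ := rfl
  leftUnitor_eqToIso _ := rfl
  rightUnitor_eqToIso _ := rfl
  associator_eqToIso _ _ _ := rfl

variable (R) in
/-- The forgetful 2-functor from `R`-Lipschitz doctrines to `R`-graded doctrines. -/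
def forget : StrictPseudofunctor (LipschitzDoctrine.{u, v, w} R) (GradedDoctrine.{u, v, w} R) :=
  StrictPseudofunctor.mk''
    { obj := fun P => P.toGradedDoctrine
      map := fun φ => Hom.toHom φ
      map₂ := fun a => a
      map₂_id := fun _ => rfl
      map₂_comp := fun _ _ => rfl
      map_id := fun _ => rfl
      map_comp := fun _ _ => rfl
      map₂_whisker_left := fun _ _ _ _ => (GradedDoctrine.id_comp_id _).symm
      map₂_whisker_right := fun _ _ => (GradedDoctrine.id_comp_id _).symm }

end LipschitzDoctrine

section Completion

open MonoidalCategory CartesianMonoidalCategory LinearDoctrine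

variable {R : Type*} [ResourceSemiring R]

namespace LinearDoctrine

variable {D : LinearDoctrine.{u, v, w}}

lemma IsDistance.refl' {A : D.C} {ρ : D.fib (A ⊗ A)} (h : IsDistance A ρ) {X : D.C} (a : X ⟶ A) :
    1 ≤ D.re (lift a a) ρ := by
  have := Doctrine.re_mono a h.refl
  rwa [D.re_one, ← Doctrine.re_comp, comp_lift, Category.comp_id] at this

lemma IsDistance.symm' {A : D.C} {ρ : D.fib (A ⊗ A)} (h : IsDistance A ρ) {X : D.C}
    (a b : X ⟶ A) : D.re (lift a b) ρ ≤ D.re (lift b a) ρ := by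
  have := Doctrine.re_mono (lift a b) h.symm
  rwa [← Doctrine.re_comp, comp_lift, lift_fst, lift_snd] at this

lemma IsDistance.trans' {A : D.C} {ρ : D.fib (A ⊗ A)} (h : IsDistance A ρ) {X : D.C}
    (a b c : X ⟶ A) : D.re (lift a b) ρ * D.re (lift b c) ρ ≤ D.re (lift a c) ρ := by
  have := Doctrine.re_mono (lift a (lift b c)) h.trans
  simpa only [D.re_mul, ← Doctrine.re_comp, comp_lift, lift_fst, lift_snd, lift_snd_assoc]
    using this

lemma IsDistance.mk' {A : D.C} {ρ : D.fib (A ⊗ A)}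
    (refl : 1 ≤ D.re (lift (𝟙 A) (𝟙 A)) ρ)
    (symm : ∀ {X : D.C} (a b : X ⟶ A), D.re (lift a b) ρ ≤ D.re (lift b a) ρ)
    (trans : ∀ {X : D.C} (a b c : X ⟶ A),
      D.re (lift a b) ρ * D.re (lift b c) ρ ≤ D.re (lift a c) ρ) : IsDistance A ρ where
  refl := refl
  symm := by simpa using symm (fst A A) (snd A A)
  trans := trans _ _ _

lemma re_boxDist {A B X : D.C} (ρ : D.fib (A ⊗ A)) (σ : D.fib (B ⊗ B)) (a a' : X ⟶ A)
    (b b' : X ⟶ B) :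
    D.re (lift (lift a b) (lift a' b')) (boxDist ρ σ) =
      D.re (lift a a') ρ * D.re (lift b b') σ := by
  simp [boxDist, D.re_mul, ← Doctrine.re_comp]

lemma re_boxDist' {A B X : D.C} (ρ : D.fib (A ⊗ A)) (σ : D.fib (B ⊗ B)) (a a' : X ⟶ A ⊗ B) :
    D.re (lift a a') (boxDist ρ σ) =
      D.re (lift (a ≫ fst _ _) (a' ≫ fst _ _)) ρ * D.re (lift (a ≫ snd _ _) (a' ≫ snd _ _)) σ := by
  simp [boxDist, D.re_mul, ← Doctrine.re_comp]

lemma IsDistance.box {A B : D.C} {ρ : D.fib (A ⊗ A)} {σ : D.fib (B ⊗ B)} (hρ : IsDistance A ρ)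
    (hσ : IsDistance B σ) : IsDistance (A ⊗ B) (boxDist ρ σ) := by
  refine .mk' ?_ (fun a b => ?_) (fun a b c => ?_)
  · rw [re_boxDist']
    exact one_le_mul (hρ.refl' _) (hσ.refl' _)
  · simp only [re_boxDist']
    exact mul_le_mul' (hρ.symm' _ _) (hσ.symm' _ _)
  · simp only [re_boxDist']
    rw [mul_mul_mul_comm]
    exact mul_le_mul' (hρ.trans' _ _ _) (hσ.trans' _ _ _)

lemma re_le_one {X Y : D.C} (f : X ⟶ Y) {α : D.fib Y} (h : IsAffine α) : D.re f α ≤ 1 :=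
  (Doctrine.re_mono f h).trans_eq (D.re_one f)

lemma IsAffine.box {A B : D.C} {ρ : D.fib (A ⊗ A)} {σ : D.fib (B ⊗ B)} (hρ : IsAffine ρ)
    (hσ : IsAffine σ) : IsAffine (boxDist ρ σ) :=
  mul_le_one' (re_le_one _ hρ) (re_le_one _ hσ)

lemma isDistance_one (A : D.C) : IsDistance A (1 : D.fib (A ⊗ A)) where
  refl := (D.re_one _).ge
  symm := (D.re_one _).ge
  trans := by simp [D.re_one]

end LinearDoctrine

/-- Objects of the base of the Lipschitz completion: objects with an affine distance. -/
structure Met (P : GradedDoctrine.{u, v, w} R) where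
  A : P.C
  ρ : P.fib (A ⊗ A)
  isDistance : IsDistance A ρ
  affine : IsAffine ρ

namespace Met

variable {P : GradedDoctrine.{u, v, w} R}

/-- `r` tracks the arrow `f` from `(A, ρ)` to `(B, σ)`. -/
def Tracks (X Y : Met P) (r : R) (f : X.A ⟶ Y.A) : Prop := P.bang r X.ρ ≤ P.re (f ⊗ₘ f) Y.ρ

/-- Arrows of the base of the Lipschitz completion: arrows tracked by some grade. -/
@[ext]
structure Hom (X Y : Met P) where
  f : X.A ⟶ Y.A
  tracked : ∃ r : R, Tracks X Y r f

instance : Category (Met P) where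
  Hom X Y := Hom X Y
  id X := ⟨𝟙 X.A, 1, by
    rw [Tracks, id_tensorHom_id, Doctrine.re_id]; exact P.mod_one X.ρ⟩
  comp {X Y Z} f g := ⟨f.f ≫ g.f, by
    obtain ⟨r, hr⟩ := f.tracked
    obtain ⟨s, hs⟩ := g.tracked
    refine ⟨s * r, (P.mod_mul_grade s r X.ρ).trans
      ((GradedDoctrine.bang_mono s hr).trans ?_)⟩
    rw [← GradedDoctrine.re_bang, ← tensorHom_comp_tensorHom, Doctrine.re_comp]
    exact Doctrine.re_mono _ hs⟩

@[ext]
lemma hom_ext {X Y : Met P} {f g : X ⟶ Y} (h : f.f = g.f) : f = g := Hom.ext h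

@[simp] lemma id_f (X : Met P) : Hom.f (𝟙 X) = 𝟙 X.A := rfl
@[simp] lemma comp_f {X Y Z : Met P} (f : X ⟶ Y) (g : Y ⟶ Z) : Hom.f (f ≫ g) = f.f ≫ g.f := rfl

variable (P) in
/-- The functor forgetting distances. -/
@[simps]
def U : Met P ⥤ P.C where
  obj X := X.A
  map f := f.f

lemma eqToHom_f {X Y : Met P} (h : X = Y) :
    Hom.f (eqToHom h) = eqToHom (congrArg Met.A h) := by subst h; rfl

variable (P) in
/-- The terminal object `(1, κ)`. -/
def one : Met P := ⟨𝟙_ P.C, 1, isDistance_one _, le_rfl⟩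

/-- The product `(A × B, ρ ⊠ σ)`. -/
def prod (X Y : Met P) : Met P :=
  ⟨X.A ⊗ Y.A, boxDist X.ρ Y.ρ, X.isDistance.box Y.isDistance, X.affine.box Y.affine⟩

def toOne (X : Met P) : X ⟶ one P :=
  ⟨toUnit X.A, 0, (P.mod_zero X.ρ).trans_eq (P.re_one _).symm⟩

def prodFst (X Y : Met P) : prod X Y ⟶ X :=
  ⟨fst X.A Y.A, 1, (P.mod_one _).trans (mul_le_of_le_one_right' (re_le_one _ Y.affine))⟩

def prodSnd (X Y : Met P) : prod X Y ⟶ Y :=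
  ⟨snd X.A Y.A, 1, (P.mod_one _).trans (mul_le_of_le_one_left' (re_le_one _ X.affine))⟩

def prodLift {X Y Z : Met P} (f : Z ⟶ X) (g : Z ⟶ Y) : Z ⟶ prod X Y :=
  ⟨lift f.f g.f, by
    obtain ⟨r, hr⟩ := f.tracked
    obtain ⟨s, hs⟩ := g.tracked
    refine ⟨r + s, (P.mod_add r s Z.ρ).trans ((mul_le_mul' hr hs).trans_eq ?_)⟩
    simp [prod, boxDist, P.re_mul, ← Doctrine.re_comp]⟩

/-- The (chosen) finite products of the base of the Lipschitz completion. -/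
instance : CartesianMonoidalCategory (Met P) :=
  .ofChosenFiniteProducts
    ⟨Limits.asEmptyCone (one P), Limits.IsTerminal.ofUniqueHom toOne
      (fun _ _ => hom_ext (toUnit_unique _ _))⟩
    (fun X Y => ⟨Limits.BinaryFan.mk (prodFst X Y) (prodSnd X Y),
      Limits.BinaryFan.IsLimit.mk _ prodLift
        (fun _ _ => hom_ext (lift_fst _ _)) (fun _ _ => hom_ext (lift_snd _ _))
        (fun _ _ _ h₁ h₂ => hom_ext (CartesianMonoidalCategory.hom_ext _ _
          ((congrArg Hom.f h₁).trans (lift_fst _ _).symm)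
          ((congrArg Hom.f h₂).trans (lift_snd _ _).symm)))⟩)

lemma tensor_eq (X Y : Met P) : X ⊗ Y = prod X Y := rfl
lemma fst_f (X Y : Met P) : Hom.f (fst X Y) = fst X.A Y.A := rfl
lemma snd_f (X Y : Met P) : Hom.f (snd X Y) = snd X.A Y.A := rfl
lemma lift_f {X Y Z : Met P} (f : Z ⟶ X) (g : Z ⟶ Y) : Hom.f (lift f g) = lift f.f g.f :=
  CartesianMonoidalCategory.hom_ext _ _
    ((congrArg Hom.f (lift_fst f g)).trans (lift_fst _ _).symm)
    ((congrArg Hom.f (lift_snd f g)).trans (lift_snd _ _).symm)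
lemma tensorHom_f {X Y X' Y' : Met P} (f : X ⟶ X') (g : Y ⟶ Y') :
    Hom.f (f ⊗ₘ g) = f.f ⊗ₘ g.f :=
  CartesianMonoidalCategory.hom_ext _ _
    ((congrArg Hom.f (tensorHom_fst f g)).trans (tensorHom_fst _ _).symm)
    ((congrArg Hom.f (tensorHom_snd f g)).trans (tensorHom_snd _ _).symm)

/-- `r` tracks the element `α` over `A` with respect to `ρ`. -/
def TracksElem (X : Met P) (r : R) (α : P.fib X.A) : Prop :=
  P.re (fst X.A X.A) α * P.bang r X.ρ ≤ P.re (snd X.A X.A) α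

lemma TracksElem.re {X : Met P} {r : R} {α : P.fib X.A} (h : TracksElem X r α) {Z : P.C}
    (a b : Z ⟶ X.A) : P.re a α * P.bang r (P.re (lift a b) X.ρ) ≤ P.re b α := by
  have := Doctrine.re_mono (lift a b) h
  rwa [P.re_mul, GradedDoctrine.re_bang, ← Doctrine.re_comp, ← Doctrine.re_comp, lift_fst,
    lift_snd] at this

/-- The `R`-graded descent data over `(A, ρ)`. -/
def Des (X : Met P) : Submonoid (P.fib X.A) where
  carrier := {α | ∃ r : R, TracksElem X r α}
  one_mem' := ⟨0, by
    rw [TracksElem, P.re_one, P.re_one, one_mul]; exact P.mod_zero X.ρ⟩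
  mul_mem' := by
    rintro α β ⟨r, hr⟩ ⟨s, hs⟩
    refine ⟨r + s, ?_⟩
    rw [TracksElem, P.re_mul, P.re_mul]
    refine (mul_le_mul' le_rfl (P.mod_add r s X.ρ)).trans ?_
    rw [mul_mul_mul_comm]
    exact mul_le_mul' hr hs

lemma re_mem_Des {X Y : Met P} (f : X ⟶ Y) {β : P.fib Y.A} (hβ : β ∈ Des Y) :
    P.re f.f β ∈ Des X := by
  obtain ⟨r, hr⟩ := f.tracked
  obtain ⟨s, hs⟩ := hβ
  refine ⟨s * r, ?_⟩
  rw [TracksElem, ← Doctrine.re_comp, ← Doctrine.re_comp]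
  refine (mul_le_mul' le_rfl ((P.mod_mul_grade s r X.ρ).trans
      (GradedDoctrine.bang_mono s hr))).trans ?_
  have := hs.re (fst X.A X.A ≫ f.f) (snd X.A X.A ≫ f.f)
  rwa [lift_fst_comp_snd_comp] at this

lemma bang_mem_Des {X : Met P} (r : R) {α : P.fib X.A} (hα : α ∈ Des X) :
    P.bang r α ∈ Des X := by
  obtain ⟨s, hs⟩ := hα
  refine ⟨r * s, ?_⟩
  rw [TracksElem, GradedDoctrine.re_bang, GradedDoctrine.re_bang]
  exact (mul_le_mul' le_rfl (P.mod_mul_grade r s X.ρ)).trans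
    ((P.mod_mul r _ _).trans (GradedDoctrine.bang_mono r hs))

variable (P) in
/-- The fibres of the Lipschitz completion. -/
def fibres : (Met P)ᵒᵖ ⥤ PartOrd.{w} where
  obj X := PartOrd.of (Des X.unop)
  map f := PartOrd.ofHom
    { toFun := fun β => ⟨P.re f.unop.f β.1, re_mem_Des f.unop β.2⟩
      monotone' := fun _ _ h => Doctrine.re_mono _ h }
  map_id X := by
    ext β
    exact Doctrine.re_id (D := P.toDoctrine) (X := X.unop.A) β.1
  map_comp f g := by
    ext β
    exact Doctrine.re_comp (D := P.toDoctrine) g.unop.f f.unop.f β.1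

variable (P) in
/-- The primary linear doctrine underlying the Lipschitz completion. -/
def linear : LinearDoctrine.{max u w, v, w} where
  C := Met P
  P := fibres P
  mon X := inferInstanceAs (CommMonoid (Des X))
  ordMon X := inferInstanceAs (IsOrderedMonoid (Des X))
  re_mul {X _} f α β := by
    refine Subtype.ext (p := (· ∈ Des X)) ?_
    exact P.re_mul (Hom.f f) α.1 β.1
  re_one {X _} f := by
    refine Subtype.ext (p := (· ∈ Des X)) ?_
    exact P.re_one (Hom.f f)

variable (P) in
/-- The `R`-graded doctrine underlying the Lipschitz completion. -/
def graded : GradedDoctrine.{max u w, v, w} R where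
  toLinearDoctrine := linear P
  mod r :=
    { app := fun X => PartOrd.ofHom
        { toFun := fun α => ⟨P.bang r α.1, bang_mem_Des r α.2⟩
          monotone' := fun _ _ h => GradedDoctrine.bang_mono r h }
      naturality := fun X Y f => by
        ext α; exact Subtype.ext (GradedDoctrine.re_bang r _ _).symm }
  one_le_mod r X := P.one_le_mod r X.A
  mod_mul r _ α β := P.mod_mul r α.1 β.1
  mod_zero α := P.mod_zero α.1
  mod_add r s _ α := P.mod_add r s α.1
  mod_one α := P.mod_one α.1
  mod_mul_grade r s _ α := P.mod_mul_grade r s α.1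
  mod_anti h _ α := P.mod_anti h α.1

/-- An element of `P(A)` which is a descent datum, as an element of the completion. -/
def mkFib {X : (graded P).C} (α : P.fib (Met.A X)) (h : α ∈ Des X) : (graded P).fib X := ⟨α, h⟩

/-- The underlying element of a descent datum. -/
def val {X : (graded P).C} (α : (graded P).fib X) : P.fib (Met.A X) := α.1

lemma val_mem {X : (graded P).C} (α : (graded P).fib X) : val α ∈ Des X := α.2
lemma val_re {X Y : (graded P).C} (f : X ⟶ Y) (α : (graded P).fib Y) :
    val ((graded P).re f α) = P.re (Hom.f f) (val α) := rfl
lemma val_mul {X : (graded P).C} (α β : (graded P).fib X) : val (α * β) = val α * val β := rfl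
lemma val_one (X : (graded P).C) : val (1 : (graded P).fib X) = 1 := rfl
lemma val_bang (r : R) {X : (graded P).C} (α : (graded P).fib X) :
    val ((graded P).bang r α) = P.bang r (val α) := rfl
lemma le_iff {X : (graded P).C} (α β : (graded P).fib X) : α ≤ β ↔ val α ≤ val β := Iff.rfl
lemma val_ext {X : (graded P).C} {α β : (graded P).fib X} (h : val α = val β) : α = β :=
  Subtype.ext (p := (· ∈ Des X)) h

lemma dist_mem_Des (X : Met P) : X.ρ ∈ Des (X ⊗ X) := by
  refine ⟨1, (mul_le_mul' le_rfl (P.mod_one _)).trans ?_⟩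
  let Z : P.C := (X.A ⊗ X.A) ⊗ (X.A ⊗ X.A)
  let p : Z ⟶ X.A ⊗ X.A := fst _ _
  let q : Z ⟶ X.A ⊗ X.A := snd _ _
  change P.re p X.ρ * boxDist X.ρ X.ρ ≤ P.re q X.ρ
  have hp : P.re p X.ρ = P.re (lift (p ≫ fst _ _) (p ≫ snd _ _)) X.ρ := by
    rw [← comp_lift, lift_fst_snd, Category.comp_id]
  have hq : P.re q X.ρ = P.re (lift (q ≫ fst _ _) (q ≫ snd _ _)) X.ρ := by
    rw [← comp_lift, lift_fst_snd, Category.comp_id]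
  have hb : boxDist X.ρ X.ρ = P.re (lift (p ≫ fst _ _) (q ≫ fst _ _)) X.ρ *
      P.re (lift (p ≫ snd _ _) (q ≫ snd _ _)) X.ρ := by
    rw [← re_boxDist', lift_fst_snd, Doctrine.re_id]
  rw [hp, hq, hb]
  have h1 := X.isDistance.symm' (p ≫ fst _ _) (q ≫ fst _ _)
  have h2 := X.isDistance.trans' (q ≫ fst _ _) (p ≫ fst _ _) (p ≫ snd _ _)
  have h3 := X.isDistance.trans' (q ≫ fst _ _) (p ≫ snd _ _) (q ≫ snd _ _)
  refine le_trans ?_ ((mul_le_mul' h2 le_rfl).trans h3)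
  rw [mul_left_comm, mul_assoc]
  exact mul_le_mul' h1 le_rfl

/-- The distance of the Lipschitz completion on `(A, ρ)` is `ρ`. -/
def dist (X : (graded P).C) : (graded P).fib (X ⊗ X) := mkFib (Met.ρ X) (dist_mem_Des X)

lemma val_dist (X : (graded P).C) : val (dist X) = Met.ρ X := rfl

lemma re_lift_f {X Y Z : Met P} (a : Z ⟶ X) (b : Z ⟶ Y) (α : P.fib (X.A ⊗ Y.A)) :
    P.re (Hom.f (lift a b) : Z.A ⟶ X.A ⊗ Y.A) α = P.re (lift a.f b.f) α :=
  congrArg (fun g => P.re g α) (lift_f a b)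

lemma re_tensorHom_f {X Y X' Y' : Met P} (a : X ⟶ X') (b : Y ⟶ Y') (α : P.fib (X'.A ⊗ Y'.A)) :
    P.re (Hom.f (a ⊗ₘ b) : X.A ⊗ Y.A ⟶ X'.A ⊗ Y'.A) α = P.re (a.f ⊗ₘ b.f) α :=
  congrArg (fun g => P.re g α) (tensorHom_f a b)

lemma dist_isDistance (X : (graded P).C) :
    IsDistance (D := (graded P).toLinearDoctrine) X (dist X) where
  refl := X.isDistance.refl.trans_eq (re_lift_f (𝟙 X) (𝟙 X) X.ρ).symm
  symm := X.isDistance.symm.trans_eq (re_lift_f (snd X X) (fst X X) X.ρ).symm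
  trans := by
    have h := X.isDistance.trans
    have h1 := re_lift_f (P := P) (fst X (X ⊗ X)) (snd X (X ⊗ X) ≫ fst X X) X.ρ
    have h2 := re_lift_f (P := P) (snd X (X ⊗ X) ≫ fst X X) (snd X (X ⊗ X) ≫ snd X X) X.ρ
    have h3 := re_lift_f (P := P) (fst X (X ⊗ X)) (snd X (X ⊗ X) ≫ snd X X) X.ρ
    exact (mul_le_mul' h1.le h2.le).trans (h.trans h3.ge)

lemma dist_prod (X Y : (graded P).C) :
    dist (X ⊗ Y) = boxDist (D := (graded P).toLinearDoctrine) (dist X) (dist Y) :=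
  val_ext (congrArg₂ (· * ·) (re_tensorHom_f (P := P) (fst X Y) (fst X Y) X.ρ).symm
    (re_tensorHom_f (P := P) (snd X Y) (snd X Y) Y.ρ).symm)

lemma dist_subst (A X : (graded P).C) (α : (graded P).fib (X ⊗ A)) : ∃ r : R,
    (graded P).re (lift (fst X (A ⊗ A)) (snd X (A ⊗ A) ≫ fst A A)) α *
        (graded P).bang r ((graded P).re (snd X (A ⊗ A)) (dist A)) ≤
      (graded P).re (lift (fst X (A ⊗ A)) (snd X (A ⊗ A) ≫ snd A A)) α := by
  obtain ⟨r, hr⟩ := val_mem α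
  refine ⟨r, ?_⟩
  have h1 := re_lift_f (P := P) (fst X (A ⊗ A)) (snd X (A ⊗ A) ≫ fst A A) (val α)
  have h2 := re_lift_f (P := P) (fst X (A ⊗ A)) (snd X (A ⊗ A) ≫ snd A A) (val α)
  have h3 := TracksElem.re hr (lift (fst X.A (A.A ⊗ A.A)) (snd X.A (A.A ⊗ A.A) ≫ fst A.A A.A))
    (lift (fst X.A (A.A ⊗ A.A)) (snd X.A (A.A ⊗ A.A) ≫ snd A.A A.A))
  have h4 : P.re (lift (lift (fst X.A (A.A ⊗ A.A)) (snd X.A (A.A ⊗ A.A) ≫ fst A.A A.A))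
      (lift (fst X.A (A.A ⊗ A.A)) (snd X.A (A.A ⊗ A.A) ≫ snd A.A A.A))) (boxDist X.ρ A.ρ) =
      P.re (lift (fst X.A (A.A ⊗ A.A)) (fst X.A (A.A ⊗ A.A))) X.ρ *
        P.re (snd X.A (A.A ⊗ A.A)) A.ρ := by
    rw [re_boxDist, ← comp_lift, lift_fst_snd, Category.comp_id]
  have h5 := GradedDoctrine.bang_mono r
    ((le_mul_of_one_le_left' (X.isDistance.refl' _)).trans_eq h4.symm)
  exact (mul_le_mul' h1.le h5).trans (h3.trans h2.ge)

end Met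

/-- The Lipschitz completion of an `R`-graded doctrine. -/
def lipCompletion (P : GradedDoctrine.{u, v, w} R) : LipschitzDoctrine.{max u w, v, w} R where
  toGradedDoctrine := Met.graded P
  dist := Met.dist
  isDistance := Met.dist_isDistance
  subst := Met.dist_subst
  dist_prod := Met.dist_prod
  dist_le_fst X Y := by
    refine (Met.dist_prod X Y).trans_le ?_
    exact mul_le_of_le_one_right' (re_le_one (D := (Met.graded P).toLinearDoctrine) _ Y.affine)
  dist_le_snd X Y := by
    refine (Met.dist_prod X Y).trans_le ?_
    exact mul_le_of_le_one_left' (re_le_one (D := (Met.graded P).toLinearDoctrine) _ X.affine)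
  dist_unit := rfl

namespace StrictlyPreservesProducts

variable {C D : Type*} [Category* C] [Category* D]
    [CartesianMonoidalCategory C] [CartesianMonoidalCategory D] {F : C ⥤ D}
    (hF : StrictlyPreservesProducts F)

lemma iso_fst (A B : C) : hF.iso A B ≫ F.map (fst A B) = fst _ _ := by
  simp [iso, hF.map_fst]

lemma iso_snd (A B : C) : hF.iso A B ≫ F.map (snd A B) = snd _ _ := by
  simp [iso, hF.map_snd]

lemma hom_ext (hF : StrictlyPreservesProducts F) {A B : C} {X : D} {g h : X ⟶ F.obj (A ⊗ B)}
    (h₁ : g ≫ F.map (fst A B) = h ≫ F.map (fst A B))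
    (h₂ : g ≫ F.map (snd A B) = h ≫ F.map (snd A B)) : g = h := by
  rw [hF.map_fst] at h₁
  rw [hF.map_snd] at h₂
  rw [← cancel_mono (eqToHom (hF.prod A B))]
  ext
  · simpa using h₁
  · simpa using h₂

lemma lift_iso {A B : C} {X : C} {Y : D} (g : Y ⟶ F.obj X) (a : X ⟶ A) (b : X ⟶ B) :
    lift (g ≫ F.map a) (g ≫ F.map b) ≫ hF.iso A B = g ≫ F.map (lift a b) := by
  apply hF.hom_ext
  · rw [Category.assoc, iso_fst, lift_fst, Category.assoc, ← F.map_comp, lift_fst]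
  · rw [Category.assoc, iso_snd, lift_snd, Category.assoc, ← F.map_comp, lift_snd]

lemma iso_natural {A A' B B' : C} (a : A ⟶ A') (b : B ⟶ B') :
    hF.iso A B ≫ F.map (a ⊗ₘ b) = (F.map a ⊗ₘ F.map b) ≫ hF.iso A' B' := by
  apply hF.hom_ext
  · rw [Category.assoc, Category.assoc, iso_fst, ← F.map_comp, tensorHom_fst, tensorHom_fst,
      F.map_comp, ← Category.assoc, iso_fst]
  · rw [Category.assoc, Category.assoc, iso_snd, ← F.map_comp, tensorHom_snd, tensorHom_snd,
      F.map_comp, ← Category.assoc, iso_snd]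

lemma iso_natTrans {G : C ⥤ D} (hG : StrictlyPreservesProducts G) (θ : F ⟶ G) (A B : C) :
    hF.iso A B ≫ θ.app (A ⊗ B) = (θ.app A ⊗ₘ θ.app B) ≫ hG.iso A B := by
  apply hG.hom_ext
  · rw [Category.assoc, Category.assoc, iso_fst, ← θ.naturality, tensorHom_fst,
      ← Category.assoc, iso_fst]
  · rw [Category.assoc, Category.assoc, iso_snd, ← θ.naturality, tensorHom_snd,
      ← Category.assoc, iso_snd]

end StrictlyPreservesProducts

namespace GradedDoctrine.Hom

variable {P : GradedDoctrine.{u, v, w} R} {Q : GradedDoctrine.{u', v', w} R} (φ : Hom P Q)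

lemma re_lift_distMap {A X : P.C} {Y : Q.C} (g : Y ⟶ φ.F.obj X) (a b : X ⟶ A)
    (ρ : P.fib (A ⊗ A)) :
    Q.re (lift (g ≫ φ.F.map a) (g ≫ φ.F.map b)) (φ.distMap ρ) =
      Q.re g (φ.app (P.re (lift a b) ρ)) := by
  rw [distMap, ← Doctrine.re_comp, φ.strict.lift_iso, Doctrine.re_comp, app_re]

lemma re_tensorHom_distMap {A X : P.C} (a : X ⟶ A) (ρ : P.fib (A ⊗ A)) :
    φ.distMap (P.re (a ⊗ₘ a) ρ) = Q.re (φ.F.map a ⊗ₘ φ.F.map a) (φ.distMap ρ) := by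
  rw [distMap, distMap, app_re, ← Doctrine.re_comp, φ.strict.iso_natural, Doctrine.re_comp]

lemma distMap_mono {A : P.C} {ρ σ : P.fib (A ⊗ A)} (h : ρ ≤ σ) : φ.distMap ρ ≤ φ.distMap σ :=
  Doctrine.re_mono _ (φ.app_mono h)

lemma distMap_mul {A : P.C} (ρ σ : P.fib (A ⊗ A)) :
    φ.distMap (ρ * σ) = φ.distMap ρ * φ.distMap σ := by
  rw [distMap, app_mul, Q.re_mul]; rfl

lemma distMap_one (A : P.C) : φ.distMap (1 : P.fib (A ⊗ A)) = 1 := by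
  rw [distMap, app_one, Q.re_one]

lemma distMap_bang (r : R) {A : P.C} (ρ : P.fib (A ⊗ A)) :
    φ.distMap (P.bang r ρ) = Q.bang r (φ.distMap ρ) := by
  rw [distMap, app_bang, GradedDoctrine.re_bang]; rfl

lemma distMap_re_fst {A : P.C} (α : P.fib A) :
    φ.distMap (P.re (fst A A) α) = Q.re (fst _ _) (φ.app α) := by
  rw [distMap, app_re, ← Doctrine.re_comp, φ.strict.iso_fst]

lemma distMap_re_snd {A : P.C} (α : P.fib A) :
    φ.distMap (P.re (snd A A) α) = Q.re (snd _ _) (φ.app α) := by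
  rw [distMap, app_re, ← Doctrine.re_comp, φ.strict.iso_snd]

lemma distMap_isDistance {A : P.C} {ρ : P.fib (A ⊗ A)} (h : IsDistance A ρ) :
    IsDistance (φ.F.obj A) (φ.distMap ρ) where
  refl := by
    have h1 := φ.re_lift_distMap (𝟙 _) (𝟙 A) (𝟙 A) ρ
    rw [φ.F.map_id, Category.comp_id, Doctrine.re_id] at h1
    rw [h1, ← φ.app_one]
    exact φ.app_mono h.refl
  symm := by
    have h1 := φ.re_lift_distMap (φ.strict.iso A A) (snd A A) (fst A A) ρ
    rw [φ.strict.iso_fst, φ.strict.iso_snd] at h1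
    rw [h1]
    exact φ.distMap_mono h.symm
  trans := by
    let g : φ.F.obj A ⊗ (φ.F.obj A ⊗ φ.F.obj A) ⟶ φ.F.obj (A ⊗ (A ⊗ A)) :=
      (φ.F.obj A ◁ φ.strict.iso A A) ≫ φ.strict.iso A (A ⊗ A)
    have g1 : g ≫ φ.F.map (fst A (A ⊗ A)) = fst _ _ := by
      rw [Category.assoc, φ.strict.iso_fst, whiskerLeft_fst]
    have g2 : g ≫ φ.F.map (snd A (A ⊗ A) ≫ fst A A) = snd _ _ ≫ fst _ _ := by
      rw [φ.F.map_comp, ← Category.assoc, Category.assoc _ (φ.strict.iso _ _), φ.strict.iso_snd,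
        whiskerLeft_snd, Category.assoc, φ.strict.iso_fst]
    have g3 : g ≫ φ.F.map (snd A (A ⊗ A) ≫ snd A A) = snd _ _ ≫ snd _ _ := by
      rw [φ.F.map_comp, ← Category.assoc, Category.assoc _ (φ.strict.iso _ _), φ.strict.iso_snd,
        whiskerLeft_snd, Category.assoc, φ.strict.iso_snd]
    rw [← g1, ← g2, ← g3, re_lift_distMap, re_lift_distMap, re_lift_distMap, ← Q.re_mul,
      ← app_mul]
    exact Doctrine.re_mono _ (φ.app_mono h.trans)

lemma distMap_isAffine {A : P.C} {ρ : P.fib (A ⊗ A)} (h : IsAffine ρ) :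
    IsAffine (φ.distMap ρ) :=
  (φ.distMap_mono h).trans_eq (φ.distMap_one A)

end GradedDoctrine.Hom

namespace Met

variable {P : GradedDoctrine.{u, v, w} R} {Q : GradedDoctrine.{u', v', w} R}

lemma ext_data {X Y : Met P} (h : X.A = Y.A)
    (hρ : X.ρ = P.re (eqToHom h ⊗ₘ eqToHom h) Y.ρ) : X = Y := by
  obtain ⟨A, ρ, _, _⟩ := X
  obtain ⟨B, σ, _, _⟩ := Y
  dsimp only at h
  subst h
  congr
  simpa using hρ

lemma mk_ext {A : P.C} {ρ σ : P.fib (A ⊗ A)} (h : ρ = σ) (h₁ : IsDistance A ρ) (h₂ : IsAffine ρ)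
    (h₁' : IsDistance A σ) (h₂' : IsAffine σ) : (⟨A, ρ, h₁, h₂⟩ : Met P) = ⟨A, σ, h₁', h₂'⟩ := by
  subst h; rfl

/-- The functor between the bases of the Lipschitz completions induced by a 1-arrow. -/
def mapBase (φ : GradedDoctrine.Hom P Q) : Met P ⥤ Met Q where
  obj X := ⟨φ.F.obj X.A, φ.distMap X.ρ, φ.distMap_isDistance X.isDistance,
    φ.distMap_isAffine X.affine⟩
  map f := ⟨φ.F.map f.f, by
    obtain ⟨r, hr⟩ := f.tracked
    refine ⟨r, ?_⟩
    have h := φ.distMap_mono hr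
    rwa [φ.distMap_bang, φ.re_tensorHom_distMap] at h⟩
  map_id X := Met.hom_ext (φ.F.map_id _)
  map_comp f g := Met.hom_ext (φ.F.map_comp _ _)

lemma mapBase_prod (φ : GradedDoctrine.Hom P Q) (X Y : Met P) :
    (mapBase φ).obj (X ⊗ Y) = (mapBase φ).obj X ⊗ (mapBase φ).obj Y := by
  refine ext_data (φ.strict.prod X.A Y.A) ?_
  change φ.distMap (boxDist X.ρ Y.ρ) =
    Q.re (eqToHom (φ.strict.prod X.A Y.A) ⊗ₘ eqToHom (φ.strict.prod X.A Y.A))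
      (boxDist (φ.distMap X.ρ) (φ.distMap Y.ρ))
  rw [boxDist, boxDist, φ.distMap_mul, φ.re_tensorHom_distMap, φ.re_tensorHom_distMap, Q.re_mul,
    ← Doctrine.re_comp, ← Doctrine.re_comp, tensorHom_comp_tensorHom, tensorHom_comp_tensorHom,
    φ.strict.map_fst, φ.strict.map_snd]

lemma mapBase_strict (φ : GradedDoctrine.Hom P Q) : StrictlyPreservesProducts (mapBase φ) where
  unit := ext_data (X := (mapBase φ).obj (one P)) (Y := one Q) φ.strict.unit
    ((φ.distMap_one _).trans (Q.re_one _).symm)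
  prod := mapBase_prod φ
  map_fst X Y := Met.hom_ext <| by
    rw [comp_f, eqToHom_f]; exact φ.strict.map_fst X.A Y.A
  map_snd X Y := Met.hom_ext <| by
    rw [comp_f, eqToHom_f]; exact φ.strict.map_snd X.A Y.A

lemma app_mem_Des (φ : GradedDoctrine.Hom P Q) {X : Met P} {α : P.fib X.A} (h : α ∈ Des X) :
    φ.app α ∈ Des ((mapBase φ).obj X) := by
  obtain ⟨r, hr⟩ := h
  refine ⟨r, ?_⟩
  have h := φ.distMap_mono hr
  rwa [φ.distMap_mul, φ.distMap_bang, φ.distMap_re_fst, φ.distMap_re_snd] at h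

/-- The action of the Lipschitz completion on 1-arrows, as a 1-arrow of graded doctrines. -/
def mapGraded (φ : GradedDoctrine.Hom P Q) : GradedDoctrine.Hom (graded P) (graded Q) where
  F := mapBase φ
  strict := mapBase_strict φ
  f :=
    { app := fun X => PartOrd.ofHom
        { toFun := fun α => ⟨φ.app α.1, app_mem_Des φ α.2⟩
          monotone' := fun _ _ h => φ.app_mono h }
      naturality := fun X Y g => by
        ext α
        exact val_ext (X := (mapBase φ).obj Y.unop) (φ.app_re (Hom.f g.unop) α.1) }
  map_mul α β := val_ext (φ.app_mul (val α) (val β))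
  map_one X := val_ext (φ.app_one _)
  map_mod r _ α := val_ext (φ.app_bang r (val α))

lemma val_mapGraded_app (φ : GradedDoctrine.Hom P Q) {X : (graded P).C} (α : (graded P).fib X) :
    val ((mapGraded φ).app α) = φ.app (val α) := rfl

lemma mapGraded_dist (φ : GradedDoctrine.Hom P Q) (X : (graded P).C) :
    dist ((mapGraded φ).F.obj X) = (mapGraded φ).distMap (dist X) := by
  refine val_ext (congrArg (fun g => Q.re g (φ.app X.ρ)) ?_)
  exact (eqToHom_f (mapBase_prod φ X X).symm).symm

lemma mapGraded_id (P : GradedDoctrine.{u, v, w} R) :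
    mapGraded (GradedDoctrine.Hom.id P) = GradedDoctrine.Hom.id (graded P) := by
  have hobj (X : Met P) : (mapBase (GradedDoctrine.Hom.id P)).obj X = X :=
    mk_ext (GradedDoctrine.Hom.distMap_id X.ρ) _ _ _ _
  refine GradedDoctrine.Hom.ext_data hobj (fun {X Y} g => ?_) (fun {X} α => ?_)
  · refine Met.hom_ext ?_
    refine Eq.trans ?_ (congrArg₂ (fun a b => a ≫ Hom.f g ≫ b) (eqToHom_f (hobj X)).symm
      (eqToHom_f (hobj Y).symm).symm)
    exact (GradedDoctrine.id_comp_id _).symm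
  · refine val_ext ?_
    exact (congrArg (fun a => P.re a (val α)) (eqToHom_f (hobj X))).trans
      (Doctrine.re_id (val α)) |>.symm

lemma mapGraded_comp {S : GradedDoctrine.{u'', v'', w} R} (φ : GradedDoctrine.Hom P Q)
    (ψ : GradedDoctrine.Hom Q S) :
    mapGraded (φ.comp ψ) = (mapGraded φ).comp (mapGraded ψ) := by
  have hobj (X : Met P) : (mapBase (φ.comp ψ)).obj X = (mapBase ψ).obj ((mapBase φ).obj X) :=
    mk_ext (GradedDoctrine.Hom.distMap_comp φ ψ X.ρ) _ _ _ _
  refine GradedDoctrine.Hom.ext_data hobj (fun {X Y} g => ?_) (fun {X} α => ?_)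
  · refine Met.hom_ext ?_
    refine Eq.trans ?_ (congrArg₂ (fun a b => a ≫ ψ.F.map (φ.F.map (Hom.f g)) ≫ b)
      (eqToHom_f (hobj X)).symm (eqToHom_f (hobj Y).symm).symm)
    exact (GradedDoctrine.id_comp_id _).symm
  · refine val_ext ?_
    exact (congrArg (fun a => S.re a (ψ.app (φ.app (val α)))) (eqToHom_f (hobj X))).trans
      (Doctrine.re_id _) |>.symm

/-- The action of the Lipschitz completion on 2-arrows. -/
def mapGraded₂ {φ ψ : GradedDoctrine.Hom P Q} (a : GradedDoctrine.Hom₂ φ ψ) :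
    GradedDoctrine.Hom₂ (mapGraded φ) (mapGraded ψ) where
  θ :=
    { app := fun X => Hom.mk (X := (mapBase φ).obj X) (Y := (mapBase ψ).obj X) (a.θ.app (Met.A X))
        ⟨1, by
          refine (Q.mod_one _).trans ?_
          change φ.distMap (Met.ρ X) ≤
            Q.re (a.θ.app (Met.A X) ⊗ₘ a.θ.app (Met.A X)) (ψ.distMap (Met.ρ X))
          rw [GradedDoctrine.Hom.distMap, GradedDoctrine.Hom.distMap, ← Doctrine.re_comp,
            ← φ.strict.iso_natTrans ψ.strict, Doctrine.re_comp]
          exact Doctrine.re_mono _ (a.ineq _)⟩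
      naturality := fun X Y g => Met.hom_ext (a.θ.naturality (Hom.f g)) }
  ineq α := a.ineq (val α)

end Met

/-- The action of the Lipschitz completion on 1-arrows. -/
def lipMap {P Q : GradedDoctrine.{max u w, v, w} R} (φ : P ⟶ Q) :
    lipCompletion.{max u w, v, w} P ⟶ lipCompletion.{max u w, v, w} Q :=
  LipschitzDoctrine.Hom.mk (P := lipCompletion P) (Q := lipCompletion Q)
    (Met.mapGraded φ) (Met.mapGraded_dist φ)

/-- The action of the Lipschitz completion on 2-arrows. -/
def lipMap₂ {P Q : GradedDoctrine.{max u w, v, w} R} {φ ψ : P ⟶ Q} (a : φ ⟶ ψ) :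
    lipMap.{u, v, w} φ ⟶ lipMap.{u, v, w} ψ := Met.mapGraded₂ a

lemma lipMap_id (P : GradedDoctrine.{max u w, v, w} R) : lipMap.{u, v, w} (𝟙 P) = 𝟙 _ :=
  LipschitzDoctrine.Hom.ext (Met.mapGraded_id P)

lemma lipMap_comp {P Q S : GradedDoctrine.{max u w, v, w} R} (φ : P ⟶ Q) (ψ : Q ⟶ S) :
    lipMap.{u, v, w} (φ ≫ ψ) = lipMap.{u, v, w} φ ≫ lipMap.{u, v, w} ψ :=
  LipschitzDoctrine.Hom.ext (Met.mapGraded_comp φ ψ)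

lemma lipCompletion_eqToHom {P : LipschitzDoctrine.{max u w, v, w} R}
    {Q : GradedDoctrine.{max u w, v, w} R} {φ ψ : P ⟶ lipCompletion.{max u w, v, w} Q}
    (h : φ = ψ) (X : P.C) :
    Met.Hom.f (P := Q) ((GradedDoctrine.Hom₂.θ (eqToHom h)).app X) =
      eqToHom (congrArg (fun χ => Met.A (P := Q) ((LipschitzDoctrine.Hom.toHom χ).F.obj X)) h) := by
  subst h; rfl

variable (R) in
/-- The Lipschitz completion 2-functor from `R`-graded doctrines to `R`-Lipschitz doctrines. -/
def completion :
    StrictPseudofunctor (GradedDoctrine.{max u w, v, w} R)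
      (LipschitzDoctrine.{max u w, v, w} R) :=
  StrictPseudofunctor.mk''
    { obj := fun P => lipCompletion.{max u w, v, w} P
      map := fun φ => lipMap.{u, v, w} φ
      map₂ := fun a => lipMap₂.{u, v, w} a
      map₂_id := fun _ => rfl
      map₂_comp := fun _ _ => rfl
      map_id := fun P => lipMap_id.{u, v, w} P
      map_comp := fun φ ψ => lipMap_comp.{u, v, w} φ ψ
      map₂_whisker_left := fun φ ψ χ a => by
        refine GradedDoctrine.hom₂_ext fun X => Met.hom_ext ?_
        refine Eq.trans ?_ (congrArg₂ (fun s t => s ≫ a.θ.app (φ.F.obj (Met.A X)) ≫ t)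
          (lipCompletion_eqToHom.{u, v, w} (lipMap_comp.{u, v, w} φ ψ) X).symm
          (lipCompletion_eqToHom.{u, v, w} (lipMap_comp.{u, v, w} φ χ).symm X).symm)
        exact (GradedDoctrine.id_comp_id _).symm
      map₂_whisker_right := fun {_ _ _ φ ψ} a χ => by
        refine GradedDoctrine.hom₂_ext fun X => Met.hom_ext ?_
        refine Eq.trans ?_ (congrArg₂ (fun s t => s ≫ χ.F.map (a.θ.app (Met.A X)) ≫ t)
          (lipCompletion_eqToHom.{u, v, w} (lipMap_comp.{u, v, w} φ χ) X).symm
          (lipCompletion_eqToHom.{u, v, w} (lipMap_comp.{u, v, w} ψ χ).symm X).symm)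
        exact (GradedDoctrine.id_comp_id _).symm }

/-- The 1-arrow from the Lipschitz completion of `P` to `P` which forgets the distances on the
base and is the inclusion on the fibres. -/
def lipCounit (P : GradedDoctrine.{u, v, w} R) : GradedDoctrine.Hom (Met.graded P) P where
  F := Met.U P
  strict := ⟨rfl, fun _ _ => rfl, fun _ _ => (Category.id_comp _).symm,
    fun _ _ => (Category.id_comp _).symm⟩
  f :=
    { app := fun X => PartOrd.ofHom
        { toFun := fun α => α.1
          monotone' := fun _ _ h => h }
      naturality := fun X Y g => by ext α; rfl }
  map_mul _ _ := rfl
  map_one _ := rfl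
  map_mod _ _ _ := rfl

namespace LipschitzDoctrine

variable (Q : LipschitzDoctrine.{u, v, w} R)

lemma dist_affine (A : Q.C) : IsAffine (Q.dist A) := by
  have h1 : Q.dist (A ⊗ 𝟙_ Q.C) = Q.re (fst A (𝟙_ Q.C) ⊗ₘ fst A (𝟙_ Q.C)) (Q.dist A) := by
    rw [Q.dist_prod, boxDist, Q.dist_unit, Q.re_one, mul_one]
  have h2 := Q.dist_le_snd A (𝟙_ Q.C)
  rw [h1, Q.dist_unit, Q.re_one] at h2
  have h3 := Doctrine.re_mono (lift (𝟙 A) (toUnit A) ⊗ₘ lift (𝟙 A) (toUnit A)) h2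
  rwa [← Doctrine.re_comp, tensorHom_comp_tensorHom, lift_fst, id_tensorHom_id, Doctrine.re_id,
    Q.re_one] at h3

/-- The object `(A, δ_A)`. -/
def toMet (A : Q.C) : Met Q.toGradedDoctrine := ⟨A, Q.dist A, Q.isDistance A, Q.dist_affine A⟩

lemma subst' {A X : Q.C} (α : Q.fib (X ⊗ A)) : ∃ r : R, ∀ {Z : Q.C} (x : Z ⟶ X) (a b : Z ⟶ A),
    Q.re (lift x a) α * Q.bang r (Q.re (lift a b) (Q.dist A)) ≤ Q.re (lift x b) α := by
  obtain ⟨r, hr⟩ := Q.subst A X α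
  refine ⟨r, fun x a b => ?_⟩
  have := Doctrine.re_mono (lift x (lift a b)) hr
  simpa only [Q.re_mul, GradedDoctrine.re_bang, ← Doctrine.re_comp, comp_lift, lift_fst, lift_snd,
    lift_snd_assoc] using this

lemma exists_tracks {A B : Q.C} (f : A ⟶ B) : ∃ r : R, Met.Tracks (Q.toMet A) (Q.toMet B) r f := by
  obtain ⟨r, hr⟩ := Q.subst' (Q.re (f ⊗ₘ f) (Q.dist B))
  refine ⟨r, ?_⟩
  have h := hr (fst A A) (fst A A) (snd A A)
  rw [lift_fst_snd, Doctrine.re_id, Doctrine.re_id, ← Doctrine.re_comp, lift_map] at h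
  exact (le_mul_of_one_le_left' ((Q.isDistance B).refl' _)).trans h

lemma exists_tracksElem {A : Q.C} (α : Q.fib A) : α ∈ Met.Des (Q.toMet A) := by
  obtain ⟨r, hr⟩ := Q.subst' (Q.re (snd (𝟙_ Q.C) A) α)
  refine ⟨r, ?_⟩
  have h := hr (toUnit _) (fst A A) (snd A A)
  rw [lift_fst_snd, Doctrine.re_id, ← Doctrine.re_comp, ← Doctrine.re_comp, lift_snd,
    lift_snd] at h
  exact h

/-- The functor `A ↦ (A, δ_A)`, the identity on arrows. -/
def toMetFunctor : Q.C ⥤ Met Q.toGradedDoctrine where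
  obj A := Q.toMet A
  map f := ⟨f, Q.exists_tracks f⟩

lemma toMet_prod (A B : Q.C) : Q.toMet (A ⊗ B) = Q.toMet A ⊗ Q.toMet B :=
  Met.mk_ext (Q.dist_prod A B) _ _ _ _

end LipschitzDoctrine

/-- The 1-arrow from an `R`-Lipschitz doctrine to the Lipschitz completion of the underlying
`R`-graded doctrine, which sends `A` to `(A, δ_A)` and is the identity on arrows and fibres. -/
def lipUnit (Q : LipschitzDoctrine.{max u w, v, w} R) :
    LipschitzDoctrine.Hom Q (lipCompletion.{max u w, v, w} Q.toGradedDoctrine) where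
  toHom :=
    { F := Q.toMetFunctor
      strict :=
        { unit := Met.mk_ext Q.dist_unit _ _ _ _
          prod := Q.toMet_prod
          map_fst := fun A B => Met.hom_ext <| by
            refine Eq.trans ?_ (congrArg (fun a => a ≫ fst A B)
              (Met.eqToHom_f (Q.toMet_prod A B)).symm)
            exact (Category.id_comp _).symm
          map_snd := fun A B => Met.hom_ext <| by
            refine Eq.trans ?_ (congrArg (fun a => a ≫ snd A B)
              (Met.eqToHom_f (Q.toMet_prod A B)).symm)
            exact (Category.id_comp _).symm }
      f :=
        { app := fun X => PartOrd.ofHom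
            { toFun := fun α => ⟨α, Q.exists_tracksElem (A := X.unop) α⟩
              monotone' := fun _ _ h => h }
          naturality := fun X Y g => by ext α; rfl }
      map_mul := fun _ _ => rfl
      map_one := fun _ => rfl
      map_mod := fun _ _ _ => rfl }
  map_dist A := by
    refine Met.val_ext ?_
    exact ((congrArg (fun g => Q.re g (Q.dist A))
      (Met.eqToHom_f (Q.toMet_prod A A).symm)).trans (Doctrine.re_id _)).symm

end Completion

end

end LipDoc

universe u v w t

/-!
The counit `U (M P) ⟶ P` is the identity on arrows and an inclusion on fibres, so a 1-arrow into
`M P` is determined by its action on objects together with its composite with the counit. Hence a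
section of the counit amounts to a choice of affine distance `δ A` on every object `A`, compatible
with the chosen products and such that every predicate on `A` is a descent datum for `δ A`; this is
exactly an `R`-Lipschitz structure on `P`, and coassociativity is then automatic. A 1-arrow commutes
with the coalgebra structures if and only if it preserves the distances, and 2-cells carry no
further condition, so the comparison 2-functor is bijective on cells of each dimension.
-/

namespace TwoCat

open CategoryTheory Bicategory

universe w₁ w₂ v₁ v₂ u₁ u₂

variable {B : Type u₁} [Bicategory.{w₁, v₁} B] {C : Type u₂} [Bicategory.{w₂, v₂} C]

lemma strictPseudofunctor_ext {F G : StrictPseudofunctor B C}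
    (hobj : ∀ a, F.obj a = G.obj a)
    (hmap : ∀ {a b : B} (f : a ⟶ b), F.map f ≍ G.map f)
    (hmap₂ : ∀ {a b : B} {f g : a ⟶ b} (η : f ⟶ g), F.map₂ η ≍ G.map₂ η) : F = G := by
  have hFcomp {a b c : B} (f : a ⟶ b) (g : b ⟶ c) := F.mapComp_eq_eqToIso f g
  have hGcomp {a b c : B} (f : a ⟶ b) (g : b ⟶ c) := G.mapComp_eq_eqToIso f g
  have hFid (a : B) := F.mapId_eq_eqToIso a
  have hGid (a : B) := G.mapId_eq_eqToIso a
  obtain ⟨⟨⟨⟨⟨⟨Fobj, Fmap⟩, Fmap₂⟩, _, _⟩, FmapId, FmapComp, _, _, _, _, _⟩, _, _⟩, _, _⟩ := F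
  obtain ⟨⟨⟨⟨⟨⟨Gobj, Gmap⟩, Gmap₂⟩, _, _⟩, GmapId, GmapComp, _, _, _, _, _⟩, _, _⟩, _, _⟩ := G
  obtain rfl : Fobj = Gobj := funext hobj
  obtain rfl : @Fmap = @Gmap := by
    funext a b f
    exact eq_of_heq (hmap f)
  obtain rfl : @Fmap₂ = @Gmap₂ := by
    funext a b f g η
    exact eq_of_heq (hmap₂ η)
  obtain rfl : FmapId = GmapId := funext fun a => (hFid a).trans (hGid a).symm
  obtain rfl : @FmapComp = @GmapComp := by
    funext a b c f g
    exact (hFcomp f g).trans (hGcomp f g).symm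
  rfl

section CategoryStruct

variable {D : Type u₂} [CategoryStruct.{v₂} D] {a b c a' b' c' : D}

lemma id_heq (ha : a = a') : 𝟙 a ≍ 𝟙 a' := by
  subst ha; rfl

lemma comp_heq (ha : a = a') (hb : b = b') (hc : c = c') {f : a ⟶ b} {f' : a' ⟶ b'}
    {g : b ⟶ c} {g' : b' ⟶ c'} (hf : f ≍ f') (hg : g ≍ g') : f ≫ g ≍ f' ≫ g' := by
  subst ha hb hc hf hg; rfl

end CategoryStruct

section Bicategory

variable {a b c a' b' c' : C}

lemma id₂_heq (ha : a = a') (hb : b = b') {f : a ⟶ b} {f' : a' ⟶ b'} (hf : f ≍ f') :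
    𝟙 f ≍ 𝟙 f' := by
  subst ha hb hf; rfl

lemma comp₂_heq (ha : a = a') (hb : b = b') {f g h : a ⟶ b} {f' g' h' : a' ⟶ b'}
    (hf : f ≍ f') (hg : g ≍ g') (hh : h ≍ h') {η : f ⟶ g} {η' : f' ⟶ g'} {θ : g ⟶ h}
    {θ' : g' ⟶ h'} (hη : η ≍ η') (hθ : θ ≍ θ') : η ≫ θ ≍ η' ≫ θ' := by
  subst ha hb hf hg hh hη hθ; rfl

lemma whiskerLeft_heq (ha : a = a') (hb : b = b') (hc : c = c') {f : a ⟶ b} {f' : a' ⟶ b'}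
    {g h : b ⟶ c} {g' h' : b' ⟶ c'} (hf : f ≍ f') (hg : g ≍ g') (hh : h ≍ h')
    {η : g ⟶ h} {η' : g' ⟶ h'} (hη : η ≍ η') : f ◁ η ≍ f' ◁ η' := by
  subst ha hb hc hf hg hh hη; rfl

lemma whiskerRight_heq (ha : a = a') (hb : b = b') (hc : c = c') {f g : a ⟶ b}
    {f' g' : a' ⟶ b'} {h : b ⟶ c} {h' : b' ⟶ c'} (hf : f ≍ f') (hg : g ≍ g') (hh : h ≍ h')
    {η : f ⟶ g} {η' : f' ⟶ g'} (hη : η ≍ η') : η ▷ h ≍ η' ▷ h' := by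
  subst ha hb hc hf hg hh hη; rfl

end Bicategory

/-- A 2-functor is bijective on cells if it is bijective on objects, on the 1-cells between any two
objects, and on the 2-cells between any two parallel 1-cells. It is then an isomorphism of
2-categories, and no transport along equalities is needed to state the condition. -/
structure IsBijectiveOnCells (F : StrictPseudofunctor B C) : Prop where
  obj : Function.Bijective F.obj
  map (a b : B) : Function.Bijective (F.map : (a ⟶ b) → (F.obj a ⟶ F.obj b))
  map₂ {a b : B} (f g : a ⟶ b) : Function.Bijective (F.map₂ : (f ⟶ g) → (F.map f ⟶ F.map g))

namespace IsBijectiveOnCells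

variable {F : StrictPseudofunctor B C} (hF : IsBijectiveOnCells F)
include hF

lemma exists_map_heq {a b : B} {c d : C} (ha : F.obj a = c) (hb : F.obj b = d) (φ : c ⟶ d) :
    ∃ f : a ⟶ b, F.map f ≍ φ := by
  subst ha hb
  exact ((hF.map a b).surjective φ).imp fun _ => heq_of_eq

lemma exists_map₂_heq {a b : B} {c d : C} (ha : F.obj a = c) (hb : F.obj b = d) {f g : a ⟶ b}
    {φ ψ : c ⟶ d} (hf : F.map f ≍ φ) (hg : F.map g ≍ ψ) (θ : φ ⟶ ψ) :
    ∃ η : f ⟶ g, F.map₂ η ≍ θ := by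
  subst ha hb hf hg
  exact ((hF.map₂ f g).surjective θ).imp fun _ => heq_of_eq

lemma map_heq_injective {a b a' b' : B} (ha : a = a') (hb : b = b') {f : a ⟶ b} {f' : a' ⟶ b'}
    (h : F.map f ≍ F.map f') : f ≍ f' := by
  subst ha hb
  exact heq_of_eq ((hF.map a b).injective (eq_of_heq h))

lemma map₂_heq_injective {a b a' b' : B} (ha : a = a') (hb : b = b') {f g : a ⟶ b}
    {f' g' : a' ⟶ b'} (hf : f ≍ f') (hg : g ≍ g') {η : f ⟶ g} {η' : f' ⟶ g'}
    (h : F.map₂ η ≍ F.map₂ η') : η ≍ η' := by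
  subst ha hb hf hg
  exact heq_of_eq ((hF.map₂ f g).injective (eq_of_heq h))

/-- The inverse on objects of a 2-functor bijective on cells. -/
noncomputable def invObj (c : C) : B := (hF.obj.surjective c).choose

lemma obj_invObj (c : C) : F.obj (hF.invObj c) = c := (hF.obj.surjective c).choose_spec

lemma invObj_obj (a : B) : hF.invObj (F.obj a) = a :=
  hF.obj.injective (hF.obj_invObj (F.obj a))

/-- The inverse on 1-cells of a 2-functor bijective on cells. -/
noncomputable def invMap {c d : C} (φ : c ⟶ d) : hF.invObj c ⟶ hF.invObj d :=
  (hF.exists_map_heq (hF.obj_invObj c) (hF.obj_invObj d) φ).choose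

lemma map_invMap {c d : C} (φ : c ⟶ d) : F.map (hF.invMap φ) ≍ φ :=
  (hF.exists_map_heq (hF.obj_invObj c) (hF.obj_invObj d) φ).choose_spec

lemma invMap_id (c : C) : hF.invMap (𝟙 c) = 𝟙 (hF.invObj c) := by
  refine (hF.map _ _).injective (eq_of_heq ((hF.map_invMap (𝟙 c)).trans ?_))
  rw [F.map_id]
  exact (id_heq (hF.obj_invObj c)).symm

lemma invMap_comp {c d e : C} (φ : c ⟶ d) (ψ : d ⟶ e) :
    hF.invMap (φ ≫ ψ) = hF.invMap φ ≫ hF.invMap ψ := by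
  refine (hF.map _ _).injective (eq_of_heq ((hF.map_invMap (φ ≫ ψ)).trans ?_))
  rw [F.map_comp]
  exact (comp_heq (hF.obj_invObj c) (hF.obj_invObj d) (hF.obj_invObj e)
    (hF.map_invMap φ) (hF.map_invMap ψ)).symm

/-- The inverse on 2-cells of a 2-functor bijective on cells. -/
noncomputable def invMap₂ {c d : C} {φ ψ : c ⟶ d} (θ : φ ⟶ ψ) : hF.invMap φ ⟶ hF.invMap ψ :=
  (hF.exists_map₂_heq (hF.obj_invObj c) (hF.obj_invObj d)
    (hF.map_invMap φ) (hF.map_invMap ψ) θ).choose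

lemma map₂_invMap₂ {c d : C} {φ ψ : c ⟶ d} (θ : φ ⟶ ψ) : F.map₂ (hF.invMap₂ θ) ≍ θ :=
  (hF.exists_map₂_heq (hF.obj_invObj c) (hF.obj_invObj d)
    (hF.map_invMap φ) (hF.map_invMap ψ) θ).choose_spec

lemma invMap₂_eq {c d : C} {φ ψ : c ⟶ d} {θ : φ ⟶ ψ} {η : hF.invMap φ ⟶ hF.invMap ψ}
    (h : F.map₂ η ≍ θ) : hF.invMap₂ θ = η :=
  (hF.map₂ _ _).injective (eq_of_heq ((hF.map₂_invMap₂ θ).trans h.symm))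

lemma invMap₂_whiskerLeft {c d e : C} (φ : c ⟶ d) {ψ ψ' : d ⟶ e} (θ : ψ ⟶ ψ') :
    hF.invMap₂ (φ ◁ θ) = eqToHom (hF.invMap_comp φ ψ) ≫ hF.invMap φ ◁ hF.invMap₂ θ ≫
      eqToHom (hF.invMap_comp φ ψ').symm := by
  refine hF.invMap₂_eq ?_
  simp only [F.map₂_comp, PrelaxFunctor.map₂_eqToHom, map₂_whiskerLeft_eq,
    Category.assoc, eqToHom_trans, eqToHom_trans_assoc]
  refine ((eqToHom_comp_heq ..).trans (comp_eqToHom_heq ..)).trans ?_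
  exact whiskerLeft_heq (hF.obj_invObj c) (hF.obj_invObj d) (hF.obj_invObj e)
    (hF.map_invMap φ) (hF.map_invMap ψ) (hF.map_invMap ψ') (hF.map₂_invMap₂ θ)

lemma invMap₂_whiskerRight {c d e : C} {φ φ' : c ⟶ d} (θ : φ ⟶ φ') (ψ : d ⟶ e) :
    hF.invMap₂ (θ ▷ ψ) = eqToHom (hF.invMap_comp φ ψ) ≫ hF.invMap₂ θ ▷ hF.invMap ψ ≫
      eqToHom (hF.invMap_comp φ' ψ).symm := by
  refine hF.invMap₂_eq ?_
  simp only [F.map₂_comp, PrelaxFunctor.map₂_eqToHom, map₂_whiskerRight_eq,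
    Category.assoc, eqToHom_trans, eqToHom_trans_assoc]
  refine ((eqToHom_comp_heq ..).trans (comp_eqToHom_heq ..)).trans ?_
  exact whiskerRight_heq (hF.obj_invObj c) (hF.obj_invObj d) (hF.obj_invObj e)
    (hF.map_invMap φ) (hF.map_invMap φ') (hF.map_invMap ψ) (hF.map₂_invMap₂ θ)

variable [Strict B] [Strict C]

/-- The inverse of a 2-functor bijective on cells, as a 2-functor. -/
noncomputable def inverse : StrictPseudofunctor C B :=
  StrictPseudofunctor.mk''
    { obj := hF.invObj
      map := hF.invMap
      map₂ := hF.invMap₂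
      map₂_id := fun φ => hF.invMap₂_eq <| by
        rw [F.map₂_id]
        exact id₂_heq (hF.obj_invObj _) (hF.obj_invObj _) (hF.map_invMap φ)
      map₂_comp := fun {_ _ φ ψ χ} θ κ => hF.invMap₂_eq <| by
        rw [F.map₂_comp]
        exact comp₂_heq (hF.obj_invObj _) (hF.obj_invObj _) (hF.map_invMap φ) (hF.map_invMap ψ)
          (hF.map_invMap χ) (hF.map₂_invMap₂ θ) (hF.map₂_invMap₂ κ)
      map_id := hF.invMap_id
      map_comp := hF.invMap_comp
      map₂_whisker_left := hF.invMap₂_whiskerLeft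
      map₂_whisker_right := hF.invMap₂_whiskerRight }

lemma comp_inverse : F.comp hF.inverse = StrictPseudofunctor.id B :=
  have map_heq {a b : B} (f : a ⟶ b) : hF.invMap (F.map f) ≍ f :=
    hF.map_heq_injective (hF.invObj_obj a) (hF.invObj_obj b) (hF.map_invMap (F.map f))
  strictPseudofunctor_ext hF.invObj_obj map_heq fun {a b f g} η =>
    hF.map₂_heq_injective (hF.invObj_obj a) (hF.invObj_obj b) (map_heq f) (map_heq g)
      (hF.map₂_invMap₂ (F.map₂ η))

lemma inverse_comp : hF.inverse.comp F = StrictPseudofunctor.id C :=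
  strictPseudofunctor_ext hF.obj_invObj hF.map_invMap hF.map₂_invMap₂

theorem isIsoOfTwoCategories : IsIsoOfTwoCategories F :=
  ⟨hF.inverse, hF.comp_inverse, hF.inverse_comp⟩

end IsBijectiveOnCells

end TwoCat

namespace TwoCat.TwoComonad.Coalgebra

open CategoryTheory Bicategory

universe w₂ v₂ u₂

variable {C : Type u₂} [Bicategory.{w₂, v₂} C] {G : TwoComonad C}

lemma mk_eq_of_str_eq (c : G.Coalgebra) {s : c.X ⟶ G.T.obj c.X} (h : s = c.str) (hcounit hcoassoc) :
    (⟨c.X, s, hcounit, hcoassoc⟩ : G.Coalgebra) = c := by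
  subst h; rfl

end TwoCat.TwoComonad.Coalgebra

namespace LipDoc

open CategoryTheory MonoidalCategory CartesianMonoidalCategory LinearDoctrine

universe u' v'

variable {R : Type*} [ResourceSemiring R]

namespace GradedDoctrine.Hom

variable {P : GradedDoctrine.{u, v, w} R} {Q : GradedDoctrine.{u', v', w} R} {φ ψ : Hom P Q}

lemma congr_obj (h : φ = ψ) (X : P.C) : φ.F.obj X = ψ.F.obj X := by rw [h]

lemma congr_map (h : φ = ψ) {X Y : P.C} (g : X ⟶ Y) :
    φ.F.map g = eqToHom (congr_obj h X) ≫ ψ.F.map g ≫ eqToHom (congr_obj h Y).symm := by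
  subst h; simp

lemma congr_app (h : φ = ψ) {X : P.C} (α : P.fib X) :
    φ.app α = Q.re (eqToHom (congr_obj h X)) (ψ.app α) := by
  subst h; simp

end GradedDoctrine.Hom

namespace Met

variable {P : GradedDoctrine.{u, v, w} R} {Q : GradedDoctrine.{u', v', w} R}

lemma ρ_eq_of_mk_eq {A : P.C} {ρ σ : P.fib (A ⊗ A)} {hρ hρ' hσ hσ'}
    (h : (⟨A, ρ, hρ, hρ'⟩ : Met P) = ⟨A, σ, hσ, hσ'⟩) : ρ = σ := by
  injection h

/-- The object `X`, with its underlying object replaced by an equal one. Only the distance is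
transported, so that the underlying object of the copy is `A` by definition. -/
def copy (X : Met P) {A : P.C} (h : X.A = A) : Met P where
  A := A
  ρ := h ▸ X.ρ
  isDistance := by subst h; exact X.isDistance
  affine := by subst h; exact X.affine

lemma copy_eq (X : Met P) {A : P.C} (h : X.A = A) : X.copy h = X := by
  subst h; rfl

lemma hom_ext_of_comp_lipCounit {φ ψ : GradedDoctrine.Hom P (graded Q)}
    (hobj : ∀ X, φ.F.obj X = ψ.F.obj X)
    (h : φ.comp (lipCounit Q) = ψ.comp (lipCounit Q)) : φ = ψ := by
  refine GradedDoctrine.Hom.ext_data hobj (fun {X Y} g => Met.hom_ext ?_)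
    (fun {X} α => val_ext ?_)
  · refine (GradedDoctrine.Hom.congr_map h g).trans ?_
    exact congrArg₂ (fun a b => a ≫ Hom.f (ψ.F.map g) ≫ b)
      (eqToHom_f (hobj X)).symm (eqToHom_f (hobj Y).symm).symm
  · refine (GradedDoctrine.Hom.congr_app h α).trans ?_
    exact congrArg (fun a => Q.re a (val (ψ.app α))) (eqToHom_f (hobj X)).symm

end Met

lemma lipUnit_naturality {P Q : LipschitzDoctrine.{max u w, v, w} R} (φ : P ⟶ Q) :
    φ ≫ (lipUnit.{u, v, w} Q : Q ⟶ lipCompletion.{max u w, v, w} Q.toGradedDoctrine) =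
      (lipUnit.{u, v, w} P : P ⟶ lipCompletion.{max u w, v, w} P.toGradedDoctrine) ≫
        lipMap.{u, v, w} (LipschitzDoctrine.Hom.toHom φ) :=
  LipschitzDoctrine.Hom.ext <|
    Met.hom_ext_of_comp_lipCounit (fun A => Met.mk_ext (φ.map_dist A) _ _ _ _) rfl

variable (R) in
/-- The unit of the 2-adjunction between the forgetful 2-functor and the Lipschitz completion. -/
def lipUnitTrans : TwoCat.TwoNatTrans
    (StrictPseudofunctor.id (LipschitzDoctrine.{max u w, v, w} R))
    ((LipschitzDoctrine.forget.{max u w, v, w} R).comp (completion.{u, v, w} R)) where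
  app Q := lipUnit.{u, v, w} Q
  naturality φ := lipUnit_naturality φ
  naturality₂ {P Q φ ψ} a := by
    refine GradedDoctrine.hom₂_ext fun X => Met.hom_ext ?_
    refine Eq.trans ?_ (congrArg₂ (fun s t => s ≫ (GradedDoctrine.Hom₂.θ a).app X ≫ t)
      (lipCompletion_eqToHom.{u, v, w} (lipUnit_naturality.{u, v, w} φ) X).symm
      (lipCompletion_eqToHom.{u, v, w} (lipUnit_naturality.{u, v, w} ψ).symm X).symm)
    exact (GradedDoctrine.id_comp_id _).symm

variable (R) in
/-- The counit of the 2-adjunction between the forgetful 2-functor and the Lipschitz completion. -/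
def lipCounitTrans : TwoCat.TwoNatTrans
    ((completion.{u, v, w} R).comp (LipschitzDoctrine.forget.{max u w, v, w} R))
    (StrictPseudofunctor.id (GradedDoctrine.{max u w, v, w} R)) where
  app P := lipCounit.{max u w, v, w} P
  naturality _ := rfl
  naturality₂ _ := GradedDoctrine.hom₂_ext fun _ => (GradedDoctrine.id_comp_id _).symm

variable (R) in
/-- The 2-adjunction between the forgetful 2-functor and the Lipschitz completion. -/
def lipAdjunction : TwoCat.TwoAdjunction
    (LipschitzDoctrine.forget.{max u w, v, w} R) (completion.{u, v, w} R) where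
  unit := lipUnitTrans.{u, v, w} R
  counit := lipCounitTrans.{u, v, w} R
  left_triangle _ := rfl
  right_triangle _ := LipschitzDoctrine.Hom.ext <|
    Met.hom_ext_of_comp_lipCounit (fun X => Met.mk_ext (Doctrine.re_id X.ρ) _ _ _ _) rfl

namespace GradedDoctrine.Hom

variable {P : GradedDoctrine.{u, v, w} R} {Q : GradedDoctrine.{u', v', w} R}
  {s : Hom P (Met.graded Q)} {φ : Hom P Q} (h : s.comp (lipCounit Q) = φ)

/-- For a lift `s` of `φ` along the counit of the Lipschitz completion, the object `s A`, with
underlying object definitionally equal to `φ A`. -/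
def liftObj (A : P.C) : Met Q := Met.copy (s.F.obj A) (congr_obj h A)

lemma liftObj_eq (A : P.C) : liftObj h A = s.F.obj A := Met.copy_eq _ _

lemma liftObj_tensorObj (A B : P.C) :
    liftObj h (A ⊗ B) = (liftObj h A ⊗ liftObj h B : Met Q) := by
  rw [liftObj_eq, liftObj_eq, liftObj_eq]
  exact s.strict.prod A B

lemma liftObj_tensorUnit : liftObj h (𝟙_ P.C) = (𝟙_ (Met Q) : Met Q) := by
  rw [liftObj_eq]
  exact s.strict.unit

lemma app_mem_Des_liftObj {A : P.C} (α : P.fib A) : φ.app α ∈ Met.Des (liftObj h A) := by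
  subst h
  exact Met.val_mem (s.app α)

end GradedDoctrine.Hom

namespace LipschitzDoctrine

/-- The `R`-Lipschitz doctrine given by affine distances on the objects of an `R`-graded doctrine
which are compatible with finite products and for which every predicate is a descent datum. -/
def ofDescent (P : GradedDoctrine.{u, v, w} R) (δ : ∀ A : P.C, P.fib (A ⊗ A))
    (isDistance : ∀ A, IsDistance A (δ A)) (affine : ∀ A, IsAffine (δ A))
    (dist_prod : ∀ A B, δ (A ⊗ B) = boxDist (δ A) (δ B)) (dist_unit : δ (𝟙_ P.C) = 1)
    (mem_Des : ∀ {A} (α : P.fib A), α ∈ Met.Des ⟨A, δ A, isDistance A, affine A⟩) :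
    LipschitzDoctrine.{u, v, w} R where
  toGradedDoctrine := P
  dist := δ
  isDistance := isDistance
  subst A X α := by
    obtain ⟨r, hr⟩ := mem_Des α
    refine ⟨r, (mul_le_mul' le_rfl (GradedDoctrine.bang_mono r ?_)).trans (hr.re _ _)⟩
    refine le_of_le_of_eq ?_ (congrArg (P.re _) (dist_prod X A)).symm
    rw [re_boxDist, ← comp_lift, lift_fst_snd, Category.comp_id]
    exact le_mul_of_one_le_left' ((isDistance X).refl' _)
  dist_prod := dist_prod
  dist_le_fst A X := (dist_prod A X).trans_le (mul_le_of_le_one_right' (re_le_one _ (affine X)))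
  dist_le_snd A X := (dist_prod A X).trans_le (mul_le_of_le_one_left' (re_le_one _ (affine A)))
  dist_unit := dist_unit

section OfSection

variable {P : GradedDoctrine.{max u w, v, w} R} {s : GradedDoctrine.Hom P (Met.graded P)}
  (hs : s.comp (lipCounit P) = GradedDoctrine.Hom.id P)

/-- The `R`-Lipschitz doctrine given by a section of the counit of the Lipschitz completion. -/
def ofSection : LipschitzDoctrine.{max u w, v, w} R :=
  ofDescent P (fun A => (GradedDoctrine.Hom.liftObj hs A).ρ)
    (fun A => (GradedDoctrine.Hom.liftObj hs A).isDistance)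
    (fun A => (GradedDoctrine.Hom.liftObj hs A).affine)
    (fun A B => Met.ρ_eq_of_mk_eq (GradedDoctrine.Hom.liftObj_tensorObj hs A B))
    (Met.ρ_eq_of_mk_eq (GradedDoctrine.Hom.liftObj_tensorUnit hs))
    (fun α => GradedDoctrine.Hom.app_mem_Des_liftObj hs α)

lemma lipUnit_ofSection : (lipUnit.{u, v, w} (ofSection hs)).toHom = s :=
  Met.hom_ext_of_comp_lipCounit (GradedDoctrine.Hom.liftObj_eq hs) hs.symm

end OfSection

lemma eq_of_lipUnit_heq {P Q : LipschitzDoctrine.{max u w, v, w} R}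
    (h : P.toGradedDoctrine = Q.toGradedDoctrine)
    (hunit : (lipUnit.{u, v, w} P).toHom ≍ (lipUnit.{u, v, w} Q).toHom) : P = Q := by
  obtain ⟨P, δ, _, _, _, _, _, _⟩ := P
  obtain ⟨Q, δ', _, _, _, _, _, _⟩ := Q
  obtain rfl : P = Q := h
  obtain rfl : δ = δ' := funext fun A =>
    Met.ρ_eq_of_mk_eq (GradedDoctrine.Hom.congr_obj (eq_of_heq hunit) A)
  rfl

lemma map_dist_of_comp_lipUnit {P Q : LipschitzDoctrine.{max u w, v, w} R}
    {φ : P.toGradedDoctrine ⟶ Q.toGradedDoctrine}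
    (h : φ ≫ (lipUnit.{u, v, w} Q).toHom = (lipUnit.{u, v, w} P).toHom ≫ Met.mapGraded φ)
    (A : P.C) : Q.dist (φ.F.obj A) = φ.distMap (P.dist A) :=
  Met.ρ_eq_of_mk_eq (GradedDoctrine.Hom.congr_obj h A)

end LipschitzDoctrine

lemma lipAdjunction_comparison_obj_bijective :
    Function.Bijective (lipAdjunction.{u, v, w} R).comparison.obj := by
  refine ⟨fun P Q h => ?_, fun c => ⟨LipschitzDoctrine.ofSection.{u, v, w} c.counit, ?_⟩⟩
  · exact LipschitzDoctrine.eq_of_lipUnit_heq (congrArg (·.X) h) (congr_arg_heq (·.str) h)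
  · exact c.mk_eq_of_str_eq (LipschitzDoctrine.lipUnit_ofSection c.counit) _ _

lemma lipAdjunction_comparison_map_bijective (P Q : LipschitzDoctrine.{max u w, v, w} R) :
    Function.Bijective (fun φ : P ⟶ Q => (lipAdjunction.{u, v, w} R).comparison.map φ) :=
  ⟨fun _ _ h => LipschitzDoctrine.Hom.ext (congrArg (·.f) h), fun φ =>
    ⟨⟨φ.f, LipschitzDoctrine.map_dist_of_comp_lipUnit φ.comm⟩, rfl⟩⟩

lemma lipAdjunction_comparison_map₂_bijective {P Q : LipschitzDoctrine.{max u w, v, w} R}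
    (φ ψ : P ⟶ Q) :
    Function.Bijective (fun a : φ ⟶ ψ => (lipAdjunction.{u, v, w} R).comparison.map₂ a) :=
  ⟨fun _ _ h => congrArg (·.η) h, fun a => ⟨a.η, rfl⟩⟩

lemma lipAdjunction_comparison_isBijectiveOnCells :
    TwoCat.IsBijectiveOnCells (lipAdjunction.{u, v, w} R).comparison where
  obj := lipAdjunction_comparison_obj_bijective
  map := lipAdjunction_comparison_map_bijective
  map₂ := lipAdjunction_comparison_map₂_bijective

end LipDoc

theorem mainTheorem1 (R : Type t) [LipDoc.ResourceSemiring R] :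
    ∃ adj : TwoCat.TwoAdjunction
        (LipDoc.LipschitzDoctrine.forget.{max u w, v, w} R) (LipDoc.completion.{u, v, w} R),
      (∀ P : LipDoc.GradedDoctrine.{max u w, v, w} R,
        adj.counit.app P = LipDoc.lipCounit.{max u w, v, w} P) ∧
      (∀ Q : LipDoc.LipschitzDoctrine.{max u w, v, w} R,
        adj.unit.app Q = LipDoc.lipUnit.{u, v, w} Q) ∧
      TwoCat.IsIsoOfTwoCategories adj.comparison :=
  ⟨LipDoc.lipAdjunction.{u, v, w} R, fun _ => rfl, fun _ => rfl,
    LipDoc.lipAdjunction_comparison_isBijectiveOnCells.isIsoOfTwoCategories⟩
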